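/- Let $p\ge 0$ and $[p]=\{1,\dots,p\}$. A graph on $[p]$ is a set $E$ of ordered pairs of distinct vertices. Write $a\to b\in G$ (arrow) if $(a,b)\in E$ and $(b,a)\notin E$, and $a - b\in G$ (line) if $(a,b),(b,a)\in E$; $a,b$ are adjacent if $(a,b)\in E$ or $(b,a)\in E$; inclusions and unions of graphs are those of the edge sets; $G+(a,b)$ adds the pair $(a,b)$ to the edge set. A DAG is a graph without lines and without directed cycles; $\mathrm{pa}_D(a)$ is the set of parents of $a$. For $I\subseteq[p]$ let $D^{(I)}$ be $D$ without the edges that point to a vertex of $I$. For each $i\in[p]$ let $(\mathcal X_i,\mathcal A_i,\mu_i)$ be a $\sigma$-finite measure space with two disjoint measurable sets of positive measure. Densities on $\mathcal X=\prod_i\mathcal X_i$ are taken with respect to $\mu=\bigotimes_i\mu_i$, and equations between (conditional) densities are understood $\mu$-almost everywhere. Let $\mathcal M(D)$ be the set of strictly positive probability densities $f$ with $f(x)=\prod_a f(x_a\mid x_{\mathrm{pa}_D(a)})$. Let $\mathcal I$ be a conservative family of targets, that is, a family (repetitions allowed) of subsets of $[p]$ such that every $a\in[p]$ lies outside some $I\in\mathcal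 I$. Let $\mathcal M_{\mathcal I}(D)$ be the set of tuples $(f^{(I)})_{I\in\mathcal I}$ with $f^{(I)}\in\mathcal M(D^{(I)})$ for all $I\in\mathcal I$ and $f^{(I)}(x_a\mid x_{\mathrm{pa}_D(a)})=f^{(J)}(x_a\mid x_{\mathrm{pa}_D(a)})$ for all $I,J\in\mathcal I$ and $a\notin I\cup J$. DAGs $D_1,D_2$ are $\mathcal I$-Markov equivalent if $\mathcal M_{\mathcal I}(D_1)=\mathcal M_{\mathcal I}(D_2)$. The $\mathcal I$-essential graph $\mathcal E_{\mathcal I}(D)$ of a DAG $D$ is the union of all DAGs that are $\mathcal I$-Markov equivalent to $D$. A partial $\mathcal I$-essential graph of $D$ is a graph $G$ with $D\subseteq G\subseteq\mathcal E_{\mathcal I}(D)$ that has no induced subgraph of the form $a\to b - c$. An arrow $a\to b$ of a graph $G$ is strongly $\mathcal I$-protected in $G$ if $|I\cap\{a,b\}|=1$ for some $I\in\mathcal I$, or if there are further, pairwise distinct vertices with one of the following properties: (a) $c\to a\in G$, with $c,b$ not adjacent; (b) $c\to b\in G$, with $c,a$ not adjacent; (c) $a\to c\in G$ and $c\to b\in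 G$; (d) $a - c_1$, $a - c_2$, $c_1\to b$, $c_2\to b\in G$, with $c_1,c_2$ not adjacent. Let $D$ be a DAG on $[p]$. 1. There is exactly one partial $\mathcal I$-essential graph of $D$ in which every arrow is strongly $\mathcal I$-protected, namely $\mathcal E_{\mathcal I}(D)$. 2. If $G$ is a partial $\mathcal I$-essential graph of $D$ and the arrow $a\to b\in G$ is not strongly $\mathcal I$-protected in $G$, then $G+(b,a)$ (the arrow is replaced by a line) is again a partial $\mathcal I$-essential graph of $D$. 3. Consequently, consider the algorithm ReplaceUnprotected: as long as $G$ has an arrow $a\to b$ that is not strongly $\mathcal I$-protected in $G$, choose one and replace $G$ by $G+(b,a)$; then return $G$. Started with any partial $\mathcal I$-essential graph $G$ of $D$, and however the arrows are chosen, it passes through partial $\mathcal I$-essential graphs of $D$ only, stops after at most as many iterations as the initial graph $G$ has arrows, and returns $\mathcal E_{\mathcal I}(D)$. -/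

import Mathlib

open MeasureTheory
open scoped ENNReal

/-- A graph on the vertex set `[p]` (here `Fin p`): a set of ordered pairs of distinct vertices. -/
@[ext]
structure MixedGraph (p : ℕ) where
  Edge : Fin p → Fin p → Prop
  ne_of_edge : ∀ a b, Edge a b → a ≠ b

namespace MixedGraph

variable {p : ℕ}

/-- `a → b ∈ G`. -/
def Arrow (G : MixedGraph p) (a b : Fin p) : Prop := G.Edge a b ∧ ¬ G.Edge b a

/-- `a — b ∈ G`. -/
def Line (G : MixedGraph p) (a b : Fin p) : Prop := G.Edge a b ∧ G.Edge b a

/-- `a` and `b` are adjacent in `G`. -/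
def Adjacent (G : MixedGraph p) (a b : Fin p) : Prop := G.Edge a b ∨ G.Edge b a

theorem Arrow.ne {G : MixedGraph p} {a b : Fin p} (h : G.Arrow a b) : a ≠ b :=
  G.ne_of_edge a b h.1

/-- `G ⊆ H`, for graphs on the same vertex set. -/
instance : LE (MixedGraph p) := ⟨fun G H => ∀ a b, G.Edge a b → H.Edge a b⟩

/-- `G + (a, b)`: the ordered pair `(a, b)` is added to the edge set. -/
def addEdge (G : MixedGraph p) (a b : Fin p) (hab : a ≠ b) : MixedGraph p where
  Edge x y := G.Edge x y ∨ (x = a ∧ y = b)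
  ne_of_edge := by
    rintro x y (h | ⟨rfl, rfl⟩)
    · exact G.ne_of_edge x y h
    · exact hab

open Classical in
/-- The set of parents of `a`. -/
noncomputable def parents (G : MixedGraph p) (a : Fin p) : Finset (Fin p) :=
  Finset.univ.filter fun b => G.Arrow b a

open Classical in
/-- The number of arrows of `G`. -/
noncomputable def numArrows (G : MixedGraph p) : ℕ :=
  (Finset.univ.filter fun e : Fin p × Fin p => G.Arrow e.1 e.2).card

/-- `G` is a directed acyclic graph: all edges are arrows, and there is no cycle of arrows. -/
def IsDAG (G : MixedGraph p) : Prop :=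
  (∀ a b, G.Edge a b → G.Arrow a b) ∧ ∀ a, ¬ Relation.TransGen G.Edge a a

/-- The intervention graph `D^(I)`: all edges pointing into `I` are removed. -/
def intervene (D : MixedGraph p) (I : Finset (Fin p)) : MixedGraph p where
  Edge a b := D.Edge a b ∧ b ∉ I
  ne_of_edge a b h := D.ne_of_edge a b h.1

end MixedGraph

section Densities

variable {p : ℕ} {X : Fin p → Type*} [∀ i, MeasurableSpace (X i)]

/-- The strictly positive probability densities w.r.t. the product measure of the `μ i`. -/
def PositiveDensities (μ : ∀ i, Measure (X i)) : Set ((∀ i, X i) → ℝ≥0∞) :=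
  {f | Measurable f ∧ (∀ x, 0 < f x ∧ f x < ∞) ∧ ∫⁻ x, f x ∂(Measure.pi μ) = 1}

/-- The marginal density `f(x_A)`, as a function of `x` which depends on `x_A` only: all
coordinates outside `A` are integrated out. -/
noncomputable def marginalDensity (μ : ∀ i, Measure (X i)) (f : (∀ i, X i) → ℝ≥0∞)
    (A : Finset (Fin p)) (x : ∀ i, X i) : ℝ≥0∞ :=
  lmarginal μ Aᶜ f x

/-- The conditional density `f(x_a | x_S)`. -/
noncomputable def condDensity (μ : ∀ i, Measure (X i)) (f : (∀ i, X i) → ℝ≥0∞)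
    (a : Fin p) (S : Finset (Fin p)) (x : ∀ i, X i) : ℝ≥0∞ :=
  marginalDensity μ f (insert a S) x / marginalDensity μ f S x

/-- The positive densities which obey the Markov property of `D`, that is, which factorize as
`f(x) = ∏ a, f(x_a | x_{pa_D(a)})`. Equations between densities hold almost everywhere. -/
def MarkovDensities (μ : ∀ i, Measure (X i)) (D : MixedGraph p) : Set ((∀ i, X i) → ℝ≥0∞) :=
  {f | f ∈ PositiveDensities μ ∧
    f =ᵐ[Measure.pi μ] fun x => ∏ a, condDensity μ f a (D.parents a) x}

variable {ι : Type*}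

/-- A family of intervention targets `(T j)_j` is conservative if every vertex lies outside
some target. -/
def IsConservative (T : ι → Finset (Fin p)) : Prop := ∀ a, ∃ j, a ∉ T j

/-- The tuples of interventional densities, indexed by the family of targets `T`: the density
belonging to the target `I` obeys the Markov property of `D^(I)`, and the densities of the
targets `I` and `J` have the same conditionals `f(x_a | x_{pa_D(a)})` for all `a ∉ I ∪ J`. -/
def InterventionalDensities (μ : ∀ i, Measure (X i)) (T : ι → Finset (Fin p))
    (D : MixedGraph p) : Set (ι → (∀ i, X i) → ℝ≥0∞) :=
  {f | (∀ j, f j ∈ MarkovDensities μ (D.intervene (T j))) ∧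
    ∀ j k, ∀ a, a ∉ T j ∪ T k →
      condDensity μ (f j) a (D.parents a) =ᵐ[Measure.pi μ] condDensity μ (f k) a (D.parents a)}

/-- Interventional Markov equivalence of two DAGs w.r.t. the family of targets `T`. -/
def InterventionallyEquivalent (μ : ∀ i, Measure (X i)) (T : ι → Finset (Fin p))
    (D₁ D₂ : MixedGraph p) : Prop :=
  InterventionalDensities μ T D₁ = InterventionalDensities μ T D₂

/-- The interventional essential graph of `D`: the union of all DAGs which are interventionally
Markov equivalent to `D`. -/
def essentialGraph (μ : ∀ i, Measure (X i)) (T : ι → Finset (Fin p)) (D : MixedGraph p) :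
    MixedGraph p where
  Edge a b := ∃ D' : MixedGraph p, D'.IsDAG ∧ InterventionallyEquivalent μ T D' D ∧ D'.Edge a b
  ne_of_edge := by
    rintro a b ⟨D', -, -, h⟩
    exact D'.ne_of_edge a b h

/-- `G` is a partial interventional essential graph of `D`: `D ⊆ G ⊆ essentialGraph μ T D`, and
`a → b — c` does not occur as an induced subgraph of `G`. -/
def IsPartialEssential (μ : ∀ i, Measure (X i)) (T : ι → Finset (Fin p))
    (D G : MixedGraph p) : Prop :=
  D ≤ G ∧ G ≤ essentialGraph μ T D ∧
    ¬ ∃ a b c, G.Arrow a b ∧ G.Line b c ∧ ¬ G.Adjacent a c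

end Densities

section Algorithm

variable {p : ℕ} {ι : Type*}

/-- Strong protection of an arrow `a → b` of `G` w.r.t. the family of targets `T`. -/
def StronglyProtected (T : ι → Finset (Fin p)) (G : MixedGraph p) (a b : Fin p) : Prop :=
  (∃ j, (T j ∩ {a, b}).card = 1) ∨
  (∃ c, G.Arrow c a ∧ c ≠ b ∧ ¬ G.Adjacent c b) ∨
  (∃ c, G.Arrow c b ∧ c ≠ a ∧ ¬ G.Adjacent c a) ∨
  (∃ c, G.Arrow a c ∧ G.Arrow c b) ∨
  (∃ c₁ c₂, G.Line a c₁ ∧ G.Line a c₂ ∧ G.Arrow c₁ b ∧ G.Arrow c₂ b ∧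
    c₁ ≠ c₂ ∧ ¬ G.Adjacent c₁ c₂)

/-- Every arrow of `G` is strongly protected in `G`. -/
def AllArrowsProtected (T : ι → Finset (Fin p)) (G : MixedGraph p) : Prop :=
  ∀ a b, G.Arrow a b → StronglyProtected T G a b

/-- `ReplaceUnprotectedRun T n G H`: starting with the graph `G`, the loop
`while there is an arrow a → b of G which is not strongly protected in G do G ← G + (b, a)`
can reach the graph `H` by `n` passes, for some choice of the arrows. -/
inductive ReplaceUnprotectedRun (T : ι → Finset (Fin p)) :
    ℕ → MixedGraph p → MixedGraph p → Prop
  | start (G : MixedGraph p) : ReplaceUnprotectedRun T 0 G G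
  | pass {n : ℕ} {G H : MixedGraph p} {a b : Fin p} (hab : G.Arrow a b)
      (hnot : ¬ StronglyProtected T G a b)
      (hrun : ReplaceUnprotectedRun T n (G.addEdge b a hab.ne.symm) H) :
      ReplaceUnprotectedRun T (n + 1) G H

/-- Some execution of the loop on the input `G` leaves the loop, with the output `H`. -/
def ReplaceUnprotectedReturns (T : ι → Finset (Fin p)) (G H : MixedGraph p) : Prop :=
  (∃ n, ReplaceUnprotectedRun T n G H) ∧ AllArrowsProtected T H

end Algorithm

/-! ### DAGs and graphical equivalence. -/

namespace MixedGraph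

variable {p : ℕ} {ι : Type*} {T : ι → Finset (Fin p)} {D D' D₁ D₂ : MixedGraph p} {a b c : Fin p}

/-! Measure theory enters only to show that interventional equivalence is graphical: it means having
the same skeleton, the same v-structures and the same orientation of every edge that some target
separates (`GraphEquivalent`). Sufficiency: graphically equivalent DAGs are joined by reversals of
covered arrows (`GraphEquivalent.induction`), and such a reversal only uses the chain rule in the
other order. Necessity: a density with a pure parity interaction on a set `Q` is Markov only if some
vertex of `Q` has the rest of `Q` among its parents; conservativeness supplies a target that leaves
this interaction visible.

The arrows of the essential graph `E` are then exactly those derived by orientation rules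
(`Compelled`). The other edges are free: a compelled arrow into one end of a free edge comes with a
compelled arrow into the other end (`Compelled.of_free`), so a perfect elimination order of the free
edges, started at any vertex, orients them without new cycles or v-structures. Protection of an
arrow in `E` is read off the last rule of its derivation.

If a partial graph `G` differs from `E`, some arrow of `G` is a line of `E`. Choose one with
earliest head and, for this head, latest tail: each protecting configuration would fix its
orientation in `E`. Conversely, arrows of `E` are protected in every partial graph, so an
unprotected arrow may be turned into a line. Each pass loses an arrow, and the loop can stop only at
`E`. -/

theorem Adjacent.symm {G : MixedGraph p} (h : G.Adjacent a b) : G.Adjacent b a := Or.symm h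

theorem Adjacent.ne {G : MixedGraph p} (h : G.Adjacent a b) : a ≠ b :=
  h.elim (G.ne_of_edge a b) fun h => (G.ne_of_edge b a h).symm

theorem IsDAG.asymm (hD : D.IsDAG) (h : D.Edge a b) : ¬ D.Edge b a := (hD.1 a b h).2

theorem IsDAG.arrow_iff (hD : D.IsDAG) : D.Arrow a b ↔ D.Edge a b := ⟨And.left, hD.1 a b⟩

theorem IsDAG.mem_parents (hD : D.IsDAG) : b ∈ D.parents a ↔ D.Edge b a := by
  simp [parents, hD.arrow_iff]

theorem IsDAG.edge_trans (hD : D.IsDAG) (hab : D.Edge a b) (hbc : D.Edge b c)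
    (hac : D.Adjacent a c) : D.Edge a c :=
  hac.resolve_right fun hca => hD.2 a (.tail (.tail (.single hab) hbc) hca)

-- The number of proper ancestors works as a rank: along an edge the ancestors of the source
-- persist, and the source itself is new by acyclicity.
open Classical in
theorem IsDAG.exists_rank (hD : D.IsDAG) :
    ∃ r : Fin p → ℕ, ∀ a b, D.Edge a b → r a < r b := by
  refine ⟨fun a => (Finset.univ.filter fun c => Relation.TransGen D.Edge c a).card,
    fun a b hab => Finset.card_lt_card (Finset.ssubset_iff_of_subset ?_ |>.2 ⟨a, ?_, ?_⟩)⟩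
  · intro c hc
    simp only [Finset.mem_filter, Finset.mem_univ, true_and] at hc ⊢
    exact hc.tail hab
  · simpa using Relation.TransGen.single hab
  · simpa using hD.2 a

/-- Among the pairs related by `P`, there is one whose second entry has minimal rank, and whose
first entry has maximal rank among the pairs with this second entry. -/
theorem exists_min_max {P : Fin p → Fin p → Prop} (r : Fin p → ℕ) (h : P a b) :
    ∃ a b, P a b ∧ (∀ x y, P x y → r b ≤ r y) ∧ ∀ x, P x b → r x ≤ r a := by
  classical
  obtain ⟨b', hb', hmin⟩ := (Finset.univ.filter fun y => ∃ x, P x y).exists_min_image r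
    ⟨b, by simpa using ⟨a, h⟩⟩
  simp only [Finset.mem_filter, Finset.mem_univ, true_and] at hb' hmin
  obtain ⟨x, hx⟩ := hb'
  obtain ⟨a', ha', hmax⟩ := (Finset.univ.filter fun x => P x b').exists_max_image r
    ⟨x, by simpa using hx⟩
  simp only [Finset.mem_filter, Finset.mem_univ, true_and] at ha' hmax
  exact ⟨a', b', ha', fun x y hxy => hmin y ⟨x, hxy⟩, hmax⟩

/-- `a → b ← c` is an induced subgraph (for DAGs). -/
def VStructure (D : MixedGraph p) (a b c : Fin p) : Prop :=
  D.Edge a b ∧ D.Edge c b ∧ a ≠ c ∧ ¬ D.Adjacent a c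

theorem VStructure.symm (h : D.VStructure a b c) : D.VStructure c b a :=
  ⟨h.2.1, h.1, h.2.2.1.symm, fun h' => h.2.2.2 h'.symm⟩

/-- Equal skeletons, equal v-structures, and equal orientation of all edges with exactly one end
in some target. -/
structure GraphEquivalent (T : ι → Finset (Fin p)) (D₁ D₂ : MixedGraph p) : Prop where
  adjacent_iff : ∀ a b, D₁.Adjacent a b ↔ D₂.Adjacent a b
  vStructure_iff : ∀ a b c, D₁.VStructure a b c ↔ D₂.VStructure a b c
  edge_of_target : ∀ j a b, ¬ (a ∈ T j ↔ b ∈ T j) → D₁.Edge a b → D₂.Edge a b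

theorem GraphEquivalent.refl : GraphEquivalent T D D :=
  ⟨fun _ _ => Iff.rfl, fun _ _ _ => Iff.rfl, fun _ _ _ _ h => h⟩

/-- The target clause is one-sided; a reversed edge of `D₁` would be transported to `D₂` and
contradict the asymmetry there. -/
theorem GraphEquivalent.symm (h₂ : D₂.IsDAG) (h : GraphEquivalent T D₁ D₂) :
    GraphEquivalent T D₂ D₁ := by
  refine ⟨fun a b => (h.1 a b).symm, fun a b c => (h.2 a b c).symm, fun j a b hj hab => ?_⟩
  refine ((h.1 a b).2 (Or.inl hab)).resolve_right fun hba => ?_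
  exact h₂.asymm hab (h.3 j b a (fun h' => hj h'.symm) hba)

theorem GraphEquivalent.trans {D₃ : MixedGraph p} (h : GraphEquivalent T D₁ D₂)
    (h' : GraphEquivalent T D₂ D₃) : GraphEquivalent T D₁ D₃ :=
  ⟨fun a b => (h.1 a b).trans (h'.1 a b), fun a b c => (h.2 a b c).trans (h'.2 a b c),
    fun j a b hj hab => h'.3 j a b hj (h.3 j a b hj hab)⟩

/-! ### Compelled arrows and free edges. -/

/-- The arrows of `D` which the orientation rules derive from the v-structures and the targets. -/
inductive Compelled (T : ι → Finset (Fin p)) (D : MixedGraph p) : Fin p → Fin p → Prop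
  | target {a b : Fin p} (j : ι) (hab : D.Edge a b) (hj : ¬ (a ∈ T j ↔ b ∈ T j)) :
      Compelled T D a b
  | collider {a b c : Fin p} (h : D.VStructure a b c) : Compelled T D a b
  | away {a b c : Fin p} (hca : Compelled T D c a) (hab : D.Edge a b) (hcb : ¬ D.Adjacent c b) :
      Compelled T D a b
  | path {a b c : Fin p} (hac : Compelled T D a c) (hcb : Compelled T D c b)
      (hab : D.Edge a b) : Compelled T D a b
  | diamond {a b c₁ c₂ : Fin p} (h₁ : Compelled T D c₁ b) (h₂ : Compelled T D c₂ b)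
      (hab : D.Edge a b) (ha₁ : D.Adjacent a c₁) (ha₂ : D.Adjacent a c₂) (hne : c₁ ≠ c₂)
      (hadj : ¬ D.Adjacent c₁ c₂) (ha : ¬ (D.Edge c₁ a ∧ D.Edge c₂ a)) : Compelled T D a b

theorem Compelled.edge (h : Compelled T D a b) : D.Edge a b := by
  cases h with
  | target j hab hj => exact hab
  | collider h => exact h.1
  | away _ hab _ => exact hab
  | path _ _ hab => exact hab
  | diamond _ _ hab => exact hab

/-- Compelled arrows are common to all graphically equivalent DAGs. -/
theorem Compelled.edge_of_graphEquivalent (hD : D.IsDAG) (hD' : D'.IsDAG)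
    (he : GraphEquivalent T D D') (h : Compelled T D a b) : D'.Edge a b := by
  induction h with
  | target j hab hj => exact he.3 j _ _ hj hab
  | collider h => exact ((he.2 _ _ _).1 h).1
  | @away a b c hca hab hcb ih =>
    refine ((he.1 a b).1 (Or.inl hab)).resolve_right fun hba => ?_
    have hne : c ≠ b := by rintro rfl; exact hD.asymm hab hca.edge
    have := (he.2 c a b).2 ⟨ih, hba, hne, fun h => hcb ((he.1 _ _).2 h)⟩
    exact hD.asymm hab this.2.1
  | path _ _ hab ih₁ ih₂ => exact hD'.edge_trans ih₁ ih₂ ((he.1 _ _).1 (Or.inl hab))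
  -- With `b → a` in `D'`, the paths `cᵢ → b → a` force the v-structure `c₁ → a ← c₂` in `D'`, hence
  -- in `D`, which `ha` excludes.
  | @diamond a b c₁ c₂ _ _ hab ha₁ ha₂ hne hadj ha ih₁ ih₂ =>
    refine ((he.1 a b).1 (Or.inl hab)).resolve_right fun hba => ha ?_
    have h₁ := hD'.edge_trans ih₁ hba ((he.1 _ _).1 ha₁.symm)
    have h₂ := hD'.edge_trans ih₂ hba ((he.1 _ _).1 ha₂.symm)
    have := (he.2 c₁ a c₂).2 ⟨h₁, h₂, hne, fun h => hadj ((he.1 _ _).2 h)⟩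
    exact ⟨this.1, this.2.1⟩

/-- The pairs of adjacent vertices whose orientation is not derived by the rules. -/
def Free (T : ι → Finset (Fin p)) (D : MixedGraph p) (a b : Fin p) : Prop :=
  D.Adjacent a b ∧ ¬ Compelled T D a b ∧ ¬ Compelled T D b a

theorem Free.symm (h : Free T D a b) : Free T D b a := ⟨h.1.symm, h.2.2, h.2.1⟩

/-- Otherwise `away` would orient the edge from `b` to `c`, or `collider` from `c` to `b`. -/
theorem Free.adjacent_of_compelled (hbc : Free T D b c) (h : Compelled T D a b) :
    D.Adjacent a c := by
  by_contra hn
  rcases hbc.1 with h' | h'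
  · exact hbc.2.1 (h.away h' hn)
  · refine hbc.2.2 (.collider (c := a) ⟨h', h.edge, ?_, fun h => hn h.symm⟩)
    rintro rfl
    exact hbc.2.2 h

theorem Free.compelled_or (hD : D.IsDAG) (hbc : Free T D b c) (h : Compelled T D a b) :
    Compelled T D a c ∨ Free T D a c := by
  have hadj := hbc.adjacent_of_compelled h
  by_cases hac : Compelled T D a c
  · exact Or.inl hac
  refine Or.inr ⟨hadj, hac, fun hca => hbc.2.2 (hca.path h ?_)⟩
  exact hD.edge_trans hca.edge h.edge hbc.1.symm

/-- Compelled arrows do not point to one end only of an edge that is not compelled. -/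
theorem Compelled.of_free (hD : D.IsDAG) (h : Compelled T D a b) :
    ∀ {c}, Free T D b c → Compelled T D a c := by
  -- Except for `path`, where the conclusion is direct, only the possibility that `a` and `c` are
  -- also joined by a free edge has to be refuted: the premises of the rule, transported to `c`,
  -- would orient one of the two free edges or contradict a non-adjacency.
  induction h with
  | @target a b j hab hj =>
    intro c hbc
    refine (hbc.compelled_or hD (.target j hab hj)).resolve_right fun hac => ?_
    have key : ∀ {x y : Fin p}, Free T D x y → (x ∈ T j ↔ y ∈ T j) := by
      intro x y hxy
      by_contra hn
      rcases hxy.1 with h | h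
      · exact hxy.2.1 (.target j h hn)
      · exact hxy.2.2 (.target j h fun h' => hn h'.symm)
    exact hj ((key hac).trans (key hbc).symm)
  | @collider a b d h =>
    intro c hbc
    refine (hbc.compelled_or hD (.collider h)).resolve_right fun hac => ?_
    have hdb : Compelled T D d b := .collider h.symm
    rcases hbc.compelled_or hD hdb with hdc | hdc
    · exact h.2.2.2 (hac.symm.adjacent_of_compelled hdc).symm
    · rcases hbc.1 with hbc' | hcb
      · have h₁ := hD.edge_trans h.1 hbc' hac.1
        have h₂ := hD.edge_trans h.2.1 hbc' hdc.1
        exact hac.2.1 (.collider ⟨h₁, h₂, h.2.2⟩)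
      · refine hbc.2.2 (.diamond (.collider h) hdb hcb hac.1.symm hdc.1.symm h.2.2.1 h.2.2.2 ?_)
        exact fun h' => hac.2.1 (.collider ⟨h'.1, h'.2, h.2.2⟩)
  | @away a b d hda hab hdb ih =>
    intro c hbc
    refine (hbc.compelled_or hD (hda.away hab hdb)).resolve_right fun hac => ?_
    exact hdb (hbc.symm.adjacent_of_compelled (ih hac))
  | @path a b d had hdb hab ih₁ ih₂ =>
    intro c hbc
    have hdc := ih₂ hbc
    refine had.path hdc (hD.edge_trans had.edge hdc.edge ?_)
    exact hbc.adjacent_of_compelled (had.path hdb hab)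
  | @diamond a b c₁ c₂ h₁ h₂ hab ha₁ ha₂ hne hadj ha ih₁ ih₂ =>
    intro c hbc
    refine (hbc.compelled_or hD (.diamond h₁ h₂ hab ha₁ ha₂ hne hadj ha)).resolve_right
      fun hac => ?_
    rcases hac.1 with hac' | hca
    · exact hac.2.1 (.diamond (ih₁ hbc) (ih₂ hbc) hac' ha₁ ha₂ hne hadj ha)
    · exact ha ⟨hD.edge_trans (ih₁ hbc).edge hca ha₁.symm,
        hD.edge_trans (ih₂ hbc).edge hca ha₂.symm⟩

theorem Compelled.of_reflTransGen_free (hD : D.IsDAG) (h : Compelled T D a b)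
    (hbc : Relation.ReflTransGen (Free T D) b c) : Compelled T D a c := by
  induction hbc with
  | refl => exact h
  | tail _ h' ih => exact ih.of_free hD h'

/-! ### Perfect elimination orders. -/

/-- A vertex outside a given clique whose neighbours form a clique exists in every set of vertices
which is not a clique itself, provided that the graph has a perfect elimination ordering `r`. -/
theorem exists_simplicial {U : Fin p → Fin p → Prop} (hU : ∀ {x y}, U x y → U y x)
    (r : Fin p → ℕ) (hr : ∀ {x y}, U x y → r x ≠ r y)
    (hP : ∀ {x y z}, U x y → U z y → r x < r y → r z < r y → x ≠ z → U x z)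
    (S K : Finset (Fin p)) (hKS : K ⊂ S) (hK : ∀ x ∈ K, ∀ y ∈ K, x ≠ y → U x y) :
    ∃ w ∈ S, w ∉ K ∧ ∀ x ∈ S, ∀ y ∈ S, U x w → U y w → x ≠ y → U x y := by
  classical
  induction S using Finset.strongInduction generalizing K with
  | H S ih =>
    obtain ⟨v, hv, hmax⟩ := S.exists_max_image r
      ((Finset.exists_of_ssubset hKS).imp fun _ h => h.1)
    have hlt : ∀ x ∈ S, U x v → r x < r v := fun x hx hxv => (hmax x hx).lt_of_ne (hr hxv)
    have hsimp : ∀ x ∈ S, ∀ y ∈ S, U x v → U y v → x ≠ y → U x y := fun x hx y hy hxv hyv =>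
      hP hxv hyv (hlt x hx hxv) (hlt y hy hyv)
    by_cases hvK : v ∈ K
    swap
    · exact ⟨v, hv, hvK, hsimp⟩
    have hsub : (S.erase v).filter (fun x => U x v) ⊆ S.erase v := Finset.filter_subset _ _
    have hKsub : ∀ x ∈ K, x ≠ v → U x v := fun x hx hxv => hK x hx v hvK hxv
    -- The last vertex `v` is simplicial but lies in `K`. If `v` is joined to all of `S`, then `S`
    -- is a clique and any vertex outside `K` will do. Otherwise the induction runs on `S` without
    -- `v`, with the neighbours of `v` as the clique to avoid: the vertex found is not joined to
    -- `v`, so it is not in `K` and has no further neighbour in `S`.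
    rcases hsub.eq_or_ssubset with heq | hss
    · obtain ⟨w, hw, hwK⟩ := Finset.exists_of_ssubset hKS
      refine ⟨w, hw, hwK, fun x hx y hy _ _ hxy => ?_⟩
      have key : ∀ x ∈ S, x ≠ v → U x v := fun x hx hxv => by
        have : x ∈ S.erase v := Finset.mem_erase.2 ⟨hxv, hx⟩
        rw [← heq] at this
        exact (Finset.mem_filter.1 this).2
      by_cases hxv : x = v
      · subst hxv; exact hU (key y hy hxy.symm)
      by_cases hyv : y = v
      · subst hyv; exact key x hx hxv
      exact hsimp x hx y hy (key x hx hxv) (key y hy hyv) hxy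
    · obtain ⟨w, hw, hwK, hws⟩ := ih _ (Finset.erase_ssubset hv) _ hss (by
        intro x hx y hy hxy
        simp only [Finset.mem_filter, Finset.mem_erase] at hx hy
        exact hsimp x hx.1.2 y hy.1.2 hx.2 hy.2 hxy)
      have hwS := Finset.mem_erase.1 hw
      have hwv : ¬ U w v := fun h => hwK (Finset.mem_filter.2 ⟨hw, h⟩)
      refine ⟨w, hwS.2, fun h => hwv (hKsub w h hwS.1), fun x hx y hy hxw hyw => ?_⟩
      have hxv : x ≠ v := by rintro rfl; exact hwv (hU hxw)
      have hyv : y ≠ v := by rintro rfl; exact hwv (hU hyw)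
      exact hws x (Finset.mem_erase.2 ⟨hxv, hx⟩) y (Finset.mem_erase.2 ⟨hyv, hy⟩) hxw hyw

/-- A graph with a perfect elimination ordering has one that starts with any given vertex. -/
theorem exists_perfect_order {U : Fin p → Fin p → Prop} (hU : ∀ {x y}, U x y → U y x)
    (hne : ∀ {x y}, U x y → x ≠ y)
    (r : Fin p → ℕ) (hr : ∀ {x y}, U x y → r x ≠ r y)
    (hP : ∀ {x y z}, U x y → U z y → r x < r y → r z < r y → x ≠ z → U x z) (b : Fin p) :
    ∃ s : Fin p → ℕ, (∀ x, x ≠ b → s b < s x) ∧ (∀ x y, x ≠ y → s x ≠ s y) ∧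
      ∀ x y z, U x y → U z y → s x < s y → s z < s y → x ≠ z → U x z := by
  classical
  suffices h : ∀ S : Finset (Fin p), b ∈ S → ∃ s : Fin p → ℕ, (∀ x ∈ S, x ≠ b → s b < s x) ∧
      (∀ x ∈ S, ∀ y ∈ S, x ≠ y → s x ≠ s y) ∧
      ∀ x ∈ S, ∀ y ∈ S, ∀ z ∈ S, U x y → U z y → s x < s y → s z < s y → x ≠ z → U x z by
    obtain ⟨s, h₁, h₂, h₃⟩ := h Finset.univ (Finset.mem_univ b)
    exact ⟨s, fun x => h₁ x (Finset.mem_univ _),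
      fun x y => h₂ x (Finset.mem_univ _) y (Finset.mem_univ _),
      fun x y z => h₃ x (Finset.mem_univ _) y (Finset.mem_univ _) z (Finset.mem_univ _)⟩
  intro S
  induction S using Finset.strongInduction with
  | H S ih =>
    intro hb
    rcases (Finset.singleton_subset_iff.2 hb).eq_or_ssubset with heq | hss
    · subst heq
      refine ⟨0, by simp, by simp, ?_⟩
      intro x hx y hy z hz hxy
      simp only [Finset.mem_singleton] at hx hy
      exact absurd (hx.trans hy.symm) (hne hxy)
    -- A simplicial vertex other than `b` is placed last, at a value `m` above all others.
    obtain ⟨w, hw, hwb, hws⟩ := exists_simplicial hU r hr hP S {b} hss (by simp)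
    rw [Finset.mem_singleton] at hwb
    obtain ⟨s, h₁, h₂, h₃⟩ := ih (S.erase w) (Finset.erase_ssubset hw)
      (Finset.mem_erase.2 ⟨Ne.symm hwb, hb⟩)
    obtain ⟨m, hm⟩ : ∃ m, ∀ x, s x < m :=
      ⟨Finset.univ.sup s + 1, fun x => Nat.lt_succ_of_le (Finset.le_sup (Finset.mem_univ x))⟩
    have hw' : Function.update s w m w = m := Function.update_self ..
    have hx' : ∀ {x}, x ≠ w → Function.update s w m x = s x := fun h =>
      Function.update_of_ne h ..
    have hE : ∀ {x}, x ∈ S → x ≠ w → x ∈ S.erase w := fun h h' => Finset.mem_erase.2 ⟨h', h⟩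
    refine ⟨Function.update s w m, fun x hx hxb => ?_, fun x hx y hy hxy => ?_,
      fun x hx y hy z hz hxy hzy hlt hlt' hxz => ?_⟩
    · rw [hx' (Ne.symm hwb)]
      by_cases hxw : x = w
      · rw [hxw, hw']; exact hm b
      · rw [hx' hxw]; exact h₁ x (hE hx hxw) hxb
    · by_cases hxw : x = w
      · subst hxw
        rw [hw', hx' (Ne.symm hxy)]
        exact (hm y).ne'
      by_cases hyw : y = w
      · subst hyw
        rw [hw', hx' hxy]
        exact (hm x).ne
      rw [hx' hxw, hx' hyw]
      exact h₂ x (hE hx hxw) y (hE hy hyw) hxy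
    · by_cases hyw : y = w
      · subst hyw
        exact hws x hx z hz hxy hzy hxz
      have hne' : ∀ {x}, Function.update s w m x < Function.update s w m y → x ≠ w := by
        rintro x h rfl
        rw [hw', hx' hyw] at h
        exact (h.trans (hm y)).false
      have hxw := hne' hlt
      have hzw := hne' hlt'
      rw [hx' hxw, hx' hyw] at hlt
      rw [hx' hzw, hx' hyw] at hlt'
      exact h₃ x (hE hx hxw) y (hE hy hyw) z (hE hz hzw) hxy hzy hlt hlt' hxz

/-! ### Orienting the free edges. -/

/-- The compelled arrows, together with the other edges oriented along `s`. -/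
def reorient (T : ι → Finset (Fin p)) (D : MixedGraph p) (s : Fin p → ℕ) : MixedGraph p where
  Edge x y := Compelled T D x y ∨ (Free T D x y ∧ s x < s y)
  ne_of_edge := by
    rintro x y (h | h)
    · exact D.ne_of_edge x y h.edge
    · exact h.1.1.ne

theorem not_transGen_compelled (hD : D.IsDAG) : ¬ Relation.TransGen (Compelled T D) a a :=
  fun h => hD.2 a (Relation.TransGen.mono (fun _ _ h => h.edge) _ _ h)

theorem TransGen.compelled_of_free (hD : D.IsDAG) (h : Relation.TransGen (Compelled T D) a b)
    (hbc : Relation.ReflTransGen (Free T D) b c) : Relation.TransGen (Compelled T D) a c := by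
  cases h with
  | single h => exact .single (h.of_reflTransGen_free hD hbc)
  | tail h h' => exact h.tail (h'.of_reflTransGen_free hD hbc)

/-- Compelled arrows absorb the free edges that follow them. So a directed path either is free and
increases `s`, or is a free path followed, up to absorption, by compelled arrows only; if it closes
up, the free part is absorbed as well and a cycle of compelled arrows of `D` remains. -/
theorem isDAG_reorient (hD : D.IsDAG) (s : Fin p → ℕ) : (reorient T D s).IsDAG := by
  refine ⟨fun x y h => ⟨h, fun h' => ?_⟩, fun x h => ?_⟩
  · rcases h with h | h <;> rcases h' with h' | h'
    · exact hD.asymm h.edge h'.edge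
    · exact h'.1.2.2 h
    · exact h.1.2.2 h'
    · exact h.2.asymm h'.2
  have key : ∀ y, Relation.TransGen (reorient T D s).Edge x y →
      (Relation.ReflTransGen (Free T D) x y ∧ s x < s y) ∨
      ∃ z, Relation.ReflTransGen (Free T D) x z ∧ Relation.TransGen (Compelled T D) z y := by
    intro y h
    induction h with
    | single h =>
      rcases h with h | h
      · exact Or.inr ⟨x, .refl, .single h⟩
      · exact Or.inl ⟨.single h.1, h.2⟩
    | tail _ h ih =>
      rcases ih with ih | ⟨z, hz, ih⟩ <;> rcases h with h | h
      · exact Or.inr ⟨_, ih.1, .single h⟩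
      · exact Or.inl ⟨ih.1.tail h.1, ih.2.trans h.2⟩
      · exact Or.inr ⟨z, hz, ih.tail h⟩
      · exact Or.inr ⟨z, hz, TransGen.compelled_of_free hD ih (.single h.1)⟩
  rcases key x h with h | ⟨z, hz, h⟩
  · exact h.2.false
  · exact not_transGen_compelled hD (TransGen.compelled_of_free hD h hz)

/-- Every adjacent pair that is not compelled can be oriented either way. -/
theorem Free.exists_graphEquivalent (hD : D.IsDAG) (h : Free T D b a) :
    ∃ D' : MixedGraph p, D'.IsDAG ∧ GraphEquivalent T D' D ∧ D'.Edge b a := by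
  obtain ⟨r, hr⟩ := hD.exists_rank
  have hlt : ∀ {x y}, D.Adjacent x y → r x < r y → D.Edge x y := fun h hxy =>
    h.resolve_right fun h' => (hr _ _ h').asymm hxy
  -- The order of `D` itself is perfect for the free edges. Free edges from `x` and `z` into `y`
  -- need `x`, `z` adjacent, else `collider` applies; and a compelled arrow between `x` and `z`
  -- would pass on to `y` by `of_free`.
  obtain ⟨s, hsb, hs, hsP⟩ := exists_perfect_order (U := Free T D) Free.symm (fun h => h.1.ne) r
    (fun h => h.1.elim (fun h => (hr _ _ h).ne) fun h => (hr _ _ h).ne') (by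
      intro x y z hxy hzy hx hz hxz
      have hadj : D.Adjacent x z := by
        by_contra hn
        exact hxy.2.1 (.collider ⟨hlt hxy.1 hx, hlt hzy.1 hz, hxz, hn⟩)
      refine ⟨hadj, fun hc => ?_, fun hc => ?_⟩
      · exact hxy.2.1 (hc.of_free hD hzy)
      · exact hzy.2.1 (hc.of_free hD hxy)) b
  have hadj : ∀ x y, (reorient T D s).Adjacent x y ↔ D.Adjacent x y := by
    intro x y
    constructor
    · rintro ((h | h) | (h | h))
      exacts [Or.inl h.edge, h.1.1, Or.inr h.edge, h.1.1.symm]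
    · intro h
      by_cases h₁ : Compelled T D x y
      · exact Or.inl (Or.inl h₁)
      by_cases h₂ : Compelled T D y x
      · exact Or.inr (Or.inl h₂)
      rcases (hs x y h.ne).lt_or_gt with h' | h'
      · exact Or.inl (Or.inr ⟨⟨h, h₁, h₂⟩, h'⟩)
      · exact Or.inr (Or.inr ⟨⟨h.symm, h₂, h₁⟩, h'⟩)
  refine ⟨reorient T D s, isDAG_reorient hD s, GraphEquivalent.symm (isDAG_reorient hD s)
    ⟨fun x y => (hadj x y).symm, fun x y z => ⟨fun hv => ?_, fun hv => ?_⟩,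
      fun j x y hj hxy => Or.inl (.target j hxy hj)⟩, Or.inr ⟨h, hsb a h.1.ne.symm⟩⟩
  · exact ⟨Or.inl (.collider hv), Or.inl (.collider hv.symm), hv.2.2.1,
      fun h => hv.2.2.2 ((hadj x z).1 h)⟩
  · obtain ⟨hxy, hzy, hxz, hn⟩ := hv
    rw [hadj] at hn
    rcases hxy with hxy | hxy <;> rcases hzy with hzy | hzy
    · exact ⟨hxy.edge, hzy.edge, hxz, hn⟩
    · exact absurd (hzy.1.symm.adjacent_of_compelled hxy) hn
    · exact absurd (hxy.1.symm.adjacent_of_compelled hzy).symm hn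
    · exact absurd (hsP x y z hxy.1 hzy.1 hxy.2 hzy.2 hxz).1 hn

/-! ### Reversal of covered arrows. -/

/-- `D` with the arrow `a → b` reversed. -/
def flip (D : MixedGraph p) (a b : Fin p) (hab : a ≠ b) : MixedGraph p where
  Edge x y := (D.Edge x y ∧ ¬ (x = a ∧ y = b)) ∨ (x = b ∧ y = a)
  ne_of_edge := by
    rintro x y (h | ⟨rfl, rfl⟩)
    · exact D.ne_of_edge x y h.1
    · exact hab.symm

/-- `a → b` is a covered arrow: the other parents of `b` are the parents of `a`. -/
def Covered (D : MixedGraph p) (a b : Fin p) : Prop :=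
  D.Edge a b ∧ ∀ c, c ≠ a → (D.Edge c b ↔ D.Edge c a)

/-- A cycle through `b → a` needs a second path from `a` to `b`. Its last edge starts at some `c ≠
a`, which is then also a parent of `a`, so `D` already has a cycle. -/
theorem Covered.isDAG_flip (hD : D.IsDAG) (h : D.Covered a b) (hab : a ≠ b) :
    (D.flip a b hab).IsDAG := by
  let R : Fin p → Fin p → Prop := fun x y => D.Edge x y ∧ ¬ (x = a ∧ y = b)
  have hR : ¬ Relation.ReflTransGen R a b := by
    intro hab'
    rcases Relation.ReflTransGen.cases_tail hab' with h' | ⟨c, hac, hcb⟩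
    · exact hab h'.symm
    · have hca : c ≠ a := fun h' => hcb.2 ⟨h', rfl⟩
      have : D.Edge c a := (h.2 c hca).1 hcb.1
      refine hD.2 a (Relation.TransGen.tail' (b := c) ?_ this)
      exact Relation.ReflTransGen.mono (fun x y h => h.1) _ _ hac
  refine ⟨fun x y hxy => ⟨hxy, fun hyx => ?_⟩, fun x hx => ?_⟩
  · rcases hxy with hxy | ⟨rfl, rfl⟩ <;> rcases hyx with hyx | hyx
    · exact hD.asymm hxy.1 hyx.1
    · exact hxy.2 ⟨hyx.2, hyx.1⟩
    · exact hyx.2 ⟨rfl, rfl⟩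
    · exact hab hyx.1
  have key : ∀ y, Relation.TransGen (D.flip a b hab).Edge x y →
      Relation.TransGen R x y ∨ (Relation.ReflTransGen R x b ∧ Relation.ReflTransGen R a y) := by
    intro y hy
    induction hy with
    | single h =>
      rcases h with h | ⟨rfl, rfl⟩
      · exact Or.inl (.single h)
      · exact Or.inr ⟨.refl, .refl⟩
    | tail _ h ih =>
      rcases ih with ih | ih <;> rcases h with h | ⟨rfl, rfl⟩
      · exact Or.inl (ih.tail h)
      · exact Or.inr ⟨ih.to_reflTransGen, .refl⟩
      · exact Or.inr ⟨ih.1, ih.2.tail h⟩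
      · exact Or.inr ⟨ih.1, .refl⟩
  rcases key x hx with h' | h'
  · exact hD.2 x (Relation.TransGen.mono (fun x y h => h.1) _ _ h')
  · exact hR (h'.2.trans h'.1)

theorem adjacent_flip (h : D.Edge a b) (hab : a ≠ b) (x y : Fin p) :
    (D.flip a b hab).Adjacent x y ↔ D.Adjacent x y := by
  simp only [Adjacent, flip]
  by_cases h₁ : x = a ∧ y = b
  · obtain ⟨rfl, rfl⟩ := h₁; simp [h]
  by_cases h₂ : y = a ∧ x = b
  · obtain ⟨rfl, rfl⟩ := h₂; simp [h]
  tauto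

/-- The reversed arrow is in no v-structure before or after: any other parent of its head is
adjacent to both ends. -/
theorem Covered.graphEquivalent_flip (h : D.Covered a b) (hab : a ≠ b)
    (hT : ∀ j, a ∈ T j ↔ b ∈ T j) : GraphEquivalent T D (D.flip a b hab) := by
  have hadj := adjacent_flip h.1 hab
  refine ⟨fun x y => (hadj x y).symm, fun x y z => ?_, fun j x y hj hxy => Or.inl ⟨hxy, ?_⟩⟩
  · simp only [VStructure, hadj]
    constructor
    · rintro ⟨hxy, hzy, hxz, hn⟩
      have key : ∀ {x z}, D.Edge x y → D.Edge z y → x ≠ z → ¬ D.Adjacent x z →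
          ¬ (x = a ∧ y = b) := by
        rintro x z hxy hzy hxz hn ⟨rfl, rfl⟩
        exact hn (Or.inr ((h.2 z hxz.symm).1 hzy))
      exact ⟨Or.inl ⟨hxy, key hxy hzy hxz hn⟩,
        Or.inl ⟨hzy, key hzy hxy hxz.symm fun h => hn h.symm⟩, hxz, hn⟩
    · rintro ⟨hxy, hzy, hxz, hn⟩
      have key : ∀ {x z}, (D.flip a b hab).Edge x y → (D.flip a b hab).Edge z y → x ≠ z →
          ¬ D.Adjacent x z → D.Edge x y := by
        rintro x z (hxy | ⟨rfl, rfl⟩) hzy hxz hn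
        · exact hxy.1
        · rcases hzy with hzy | hzy
          · exact absurd (Or.inr ((h.2 z (D.ne_of_edge _ _ hzy.1)).2 hzy.1)) hn
          · exact absurd hzy.1.symm hxz
      exact ⟨key hxy hzy hxz hn, key hzy hxy hxz.symm fun h => hn h.symm, hxz, hn⟩
  · rintro ⟨rfl, rfl⟩
    exact hj (hT j)

/-- Two different equivalent DAGs disagree on an arrow which is covered in the first one. -/
theorem GraphEquivalent.exists_covered (h₁ : D₁.IsDAG) (h₂ : D₂.IsDAG)
    (h : GraphEquivalent T D₁ D₂) (hab : D₁.Edge a b) (hba : D₂.Edge b a) :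
    ∃ a b, D₁.Covered a b ∧ D₂.Edge b a ∧ ∀ j, a ∈ T j ↔ b ∈ T j := by
  obtain ⟨r, hr⟩ := h₁.exists_rank
  -- Earliest head `b`, then latest tail `a`. Were `a → c → b` in `D₁`, maximality of `a` would give
  -- `c → b` in `D₂` and minimality of `b` would give `a → c`, a cycle with `b → a`.
  obtain ⟨a, b, ⟨hab, hba⟩, hmin, hmax⟩ :=
    exists_min_max (P := fun x y => D₁.Edge x y ∧ D₂.Edge y x) r ⟨hab, hba⟩
  have hagree : ∀ {x y}, r y < r b → D₁.Edge x y → D₂.Edge x y := fun hy hxy =>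
    ((h.1 _ _).1 (Or.inl hxy)).resolve_right fun hyx => (hmin _ _ ⟨hxy, hyx⟩).not_gt hy
  refine ⟨a, b, ⟨hab, fun c hca => ⟨fun hcb => ?_, fun hca' => ?_⟩⟩, hba, fun j => ?_⟩
  · have hadj : D₁.Adjacent c a := by
      by_contra hn
      exact h₂.asymm hba ((h.2 c b a).1 ⟨hcb, hab, hca, hn⟩).2.1
    refine hadj.resolve_right fun hac => ?_
    have hcb' : D₂.Edge c b := ((h.1 _ _).1 (Or.inl hcb)).resolve_right fun hbc =>
      (hmax c ⟨hcb, hbc⟩).not_gt (hr _ _ hac)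
    exact h₂.asymm (h₂.edge_trans hcb' hba ((h.1 _ _).1 hadj)) (hagree (hr _ _ hcb) hac)
  · have hadj : D₁.Adjacent c b := by
      by_contra hn
      have hcb : c ≠ b := by rintro rfl; exact h₁.asymm hab hca'
      have := (h.2 c a b).2 ⟨hagree (hr _ _ hab) hca', hba, hcb, fun h' => hn ((h.1 _ _).2 h')⟩
      exact h₁.asymm hab this.2.1
    exact h₁.edge_trans hca' hab hadj
  · by_contra hj
    exact h₂.asymm hba (h.3 j a b hj hab)

/-- A property which is invariant under the reversal of covered arrows that no target separates
is invariant under graphical equivalence. -/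
theorem GraphEquivalent.induction {P : MixedGraph p → Prop}
    (hP : ∀ (D : MixedGraph p) (a b : Fin p) (hab : a ≠ b), D.IsDAG → D.Covered a b →
      (∀ j, a ∈ T j ↔ b ∈ T j) → P (D.flip a b hab) → P D)
    (h₁ : D₁.IsDAG) (h₂ : D₂.IsDAG) (h : GraphEquivalent T D₁ D₂) (hP₂ : P D₂) : P D₁ := by
  classical
  obtain ⟨n, hn⟩ : ∃ n, (Finset.univ.filter fun e : Fin p × Fin p =>
    D₁.Edge e.1 e.2 ∧ D₂.Edge e.2 e.1).card = n := ⟨_, rfl⟩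
  induction n using Nat.strong_induction_on generalizing D₁ with
  | _ n ih =>
    by_cases hex : ∃ a b, D₁.Edge a b ∧ D₂.Edge b a
    · obtain ⟨a, b, hab, hba⟩ := hex
      obtain ⟨a, b, hc, hba, hT⟩ := h.exists_covered h₁ h₂ hab hba
      have hne := D₁.ne_of_edge _ _ hc.1
      have hdag := hc.isDAG_flip h₁ hne
      refine hP D₁ a b hne h₁ hc hT (ih _ ?_ hdag
        ((GraphEquivalent.symm hdag (hc.graphEquivalent_flip hne hT)).trans h) rfl)
      rw [← hn]
      refine Finset.card_lt_card (Finset.ssubset_iff_of_subset ?_ |>.2 ⟨(a, b), ?_, ?_⟩)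
      · rintro ⟨x, y⟩ hxy
        simp only [Finset.mem_filter, Finset.mem_univ, true_and] at hxy ⊢
        rcases hxy with ⟨h' | ⟨rfl, rfl⟩, h''⟩
        · exact ⟨h'.1, h''⟩
        · exact absurd h'' (h₂.asymm hba)
      · simpa using ⟨hc.1, hba⟩
      · simp [flip, hne]
    · push Not at hex
      have : D₁ = D₂ := by
        ext x y
        constructor
        · exact fun hxy => ((h.1 x y).1 (Or.inl hxy)).resolve_right (hex x y hxy)
        · exact fun hxy => ((h.1 x y).2 (Or.inl hxy)).resolve_right fun hyx => hex y x hyx hxy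
      rwa [this]

end MixedGraph

/-! ### Marginal and conditional densities. -/

section Marginals

variable {p : ℕ} {X : Fin p → Type*} [∀ i, MeasurableSpace (X i)]
  {μ : ∀ i, Measure (X i)} {f g : (∀ i, X i) → ℝ≥0∞} {S : Finset (Fin p)} {a b : Fin p}

theorem lmarginal_mul_right (hf : Measurable f) (hg : ∀ x y, g (Function.updateFinset x S y) = g x)
    (x : ∀ i, X i) : lmarginal μ S (fun x => f x * g x) x = lmarginal μ S f x * g x := by
  simp only [lmarginal, hg]
  exact lintegral_mul_const _ (hf.comp measurable_updateFinset)

theorem marginalDensity_update (ha : a ∉ S) (x : ∀ i, X i)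
    (y : ∀ i : ({a} : Finset (Fin p)), X i) :
    marginalDensity μ f S (Function.updateFinset x {a} y) = marginalDensity μ f S x := by
  refine lmarginal_congr μ f fun i hi => ?_
  have hia : i ∉ ({a} : Finset (Fin p)) := by
    rintro h
    rw [Finset.mem_singleton] at h
    subst h
    exact hi (Finset.mem_compl.2 ha)
  simp [Function.updateFinset, hia]

variable [∀ i, SigmaFinite (μ i)]

theorem lmarginal_union_compl (hf : Measurable f) (s : Finset (Fin p)) :
    lmarginal μ s (lmarginal μ sᶜ f) = fun _ => ∫⁻ x, f x ∂Measure.pi μ := by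
  rw [← lmarginal_union μ f hf disjoint_compl_right, Finset.union_compl, lmarginal_univ]

theorem lmarginal_pos (hμ : ∀ i, μ i ≠ 0) (hf : Measurable f) (hpos : ∀ x, 0 < f x)
    (s : Finset (Fin p)) (x : ∀ i, X i) : 0 < lmarginal μ s f x := by
  refine (lintegral_pos_iff_support (hf.comp measurable_updateFinset)).2 ?_
  have : Function.support (f ∘ Function.updateFinset x s) = Set.univ :=
    Set.eq_univ_of_forall fun y => (hpos _).ne'
  rw [this, Measure.pi_univ]
  exact pos_iff_ne_zero.2 (Finset.prod_ne_zero_iff.2 fun i _ => by simpa using hμ i)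

/-- Integrating the marginal over the remaining coordinates gives the finite total mass, so the
infinite values form a null set. -/
theorem ae_lmarginal_lt_top (hf : Measurable f) (hint : ∫⁻ x, f x ∂Measure.pi μ ≠ ∞)
    (s : Finset (Fin p)) : ∀ᵐ x ∂Measure.pi μ, lmarginal μ s f x < ∞ := by
  have hm : Measurable (lmarginal μ s f) := hf.lmarginal μ
  have hN : MeasurableSet {x | lmarginal μ s f x = ∞} := hm (measurableSet_singleton _)
  have h0 : lmarginal μ sᶜ ({x | lmarginal μ s f x = ∞}.indicator 1) = lmarginal μ sᶜ 0 := by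
    ext x
    refine lintegral_congr_ae ?_
    have hx : ∫⁻ y, lmarginal μ s f (Function.updateFinset x sᶜ y)
        ∂Measure.pi (fun i : ↥(sᶜ) => μ i) ≠ ∞ := by
      have := congrFun (lmarginal_union_compl (μ := μ) hf sᶜ) x
      rw [compl_compl] at this
      rw [lmarginal] at this
      rwa [this]
    filter_upwards [ae_lt_top (hm.comp measurable_updateFinset) hx] with y hy
    simpa using hy.ne
  have := lintegral_eq_of_lmarginal_eq sᶜ ((measurable_one).indicator hN) measurable_zero h0
  rw [lintegral_indicator_one hN] at this
  simp only [Pi.zero_apply, lintegral_zero] at this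
  filter_upwards [measure_eq_zero_iff_ae_notMem.1 this] with x hx
  exact lt_top_iff_ne_top.2 hx

/-- By Fubini, almost every fibre meets the null set where `f` and `g` differ in a null set. -/
theorem lmarginal_congr_ae (hf : Measurable f) (hg : Measurable g)
    (hfg : f =ᵐ[Measure.pi μ] g) (s : Finset (Fin p)) :
    lmarginal μ s f =ᵐ[Measure.pi μ] lmarginal μ s g := by
  have hN : MeasurableSet {x | f x ≠ g x} := (measurableSet_eq_fun hf hg).compl
  have hi : Measurable ({x | f x ≠ g x}.indicator (1 : (∀ i, X i) → ℝ≥0∞)) :=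
    measurable_one.indicator hN
  have hm := hi.lmarginal μ (s := s)
  have h0 : ∫⁻ x, lmarginal μ s ({x | f x ≠ g x}.indicator 1) x ∂Measure.pi μ = 0 := by
    have h1 := lmarginal_union_compl (μ := μ) hi sᶜ
    rw [compl_compl, lintegral_indicator_one hN] at h1
    have h2 : Measure.pi μ {x | f x ≠ g x} = 0 := hfg
    rw [h2] at h1
    rw [lintegral_eq_of_lmarginal_eq sᶜ hm measurable_zero (h1.trans ?_)]
    · simp
    · ext x; simp [lmarginal]
  filter_upwards [(lintegral_eq_zero_iff hm).1 h0] with x hx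
  have := (lintegral_eq_zero_iff (hi.comp measurable_updateFinset)).1 hx
  refine lintegral_congr_ae ?_
  filter_upwards [this] with y hy
  by_contra hne
  have : Function.updateFinset x s y ∈ {x | f x ≠ g x} := hne
  simp [this] at hy

theorem measurable_marginalDensity (hf : Measurable f) (A : Finset (Fin p)) :
    Measurable (marginalDensity μ f A) := hf.lmarginal μ

theorem lmarginal_marginalDensity (hf : Measurable f) (ha : a ∉ S) :
    lmarginal μ {a} (marginalDensity μ f (insert a S)) = marginalDensity μ f S := by
  have h : Sᶜ = {a} ∪ (insert a S)ᶜ := by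
    ext i
    by_cases hi : i = a
    · subst hi; simp [ha]
    · simp [hi]
  change lmarginal μ {a} (lmarginal μ (insert a S)ᶜ f) = lmarginal μ Sᶜ f
  rw [h, lmarginal_union μ f hf (by simp)]

theorem ae_marginalDensity (hμ : ∀ i, μ i ≠ 0) (hf : f ∈ PositiveDensities μ)
    (A : Finset (Fin p)) : ∀ᵐ x ∂Measure.pi μ,
      marginalDensity μ f A x ≠ 0 ∧ marginalDensity μ f A x ≠ ∞ := by
  filter_upwards [ae_lmarginal_lt_top hf.1 (by rw [hf.2.2]; simp) Aᶜ] with x hx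
  exact ⟨(lmarginal_pos hμ hf.1 (fun x => (hf.2.1 x).1) _ x).ne', hx.ne⟩

theorem ENNReal.div_mul_div_telescope {u v w : ℝ≥0∞} (h₀ : v ≠ 0) (h : v ≠ ∞) :
    v / w * (u / v) = u / w := by
  rw [mul_comm, div_eq_mul_inv, div_eq_mul_inv, mul_assoc, ← mul_assoc v⁻¹,
    ENNReal.inv_mul_cancel h₀ h, one_mul, div_eq_mul_inv]

/-- The chain rule for conditional densities. -/
theorem condDensity_mul (hμ : ∀ i, μ i ≠ 0) (hf : f ∈ PositiveDensities μ)
    (a b : Fin p) (S : Finset (Fin p)) :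
    (fun x => condDensity μ f a S x * condDensity μ f b (insert a S) x) =ᵐ[Measure.pi μ]
      fun x => marginalDensity μ f (insert b (insert a S)) x / marginalDensity μ f S x := by
  filter_upwards [ae_marginalDensity hμ hf (insert a S)] with x hx
  exact ENNReal.div_mul_div_telescope hx.1 hx.2

theorem condDensity_mul_comm (hμ : ∀ i, μ i ≠ 0) (hf : f ∈ PositiveDensities μ)
    (a b : Fin p) (S : Finset (Fin p)) :
    (fun x => condDensity μ f a S x * condDensity μ f b (insert a S) x) =ᵐ[Measure.pi μ]
      fun x => condDensity μ f b S x * condDensity μ f a (insert b S) x := by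
  refine (condDensity_mul hμ hf a b S).trans ?_
  rw [Finset.insert_comm]
  exact (condDensity_mul hμ hf b a S).symm

/-- The two factors of the chain rule determine those of the chain rule in the other order. -/
theorem condDensity_swap (hμ : ∀ i, μ i ≠ 0) (hf : f ∈ PositiveDensities μ)
    (hg : g ∈ PositiveDensities μ) (hab : a ≠ b) (ha : a ∉ S)
    (h₁ : condDensity μ f a S =ᵐ[Measure.pi μ] condDensity μ g a S)
    (h₂ : condDensity μ f b (insert a S) =ᵐ[Measure.pi μ] condDensity μ g b (insert a S)) :
    condDensity μ f b S =ᵐ[Measure.pi μ] condDensity μ g b S ∧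
    condDensity μ f a (insert b S) =ᵐ[Measure.pi μ] condDensity μ g a (insert b S) := by
  -- Both orders of the chain rule give the joint density of `a`, `b` given `S`. Integrating out `a`
  -- yields the conditional of `b` given `S`; dividing by that yields the conditional of `a`.
  have hjoint : (fun x => marginalDensity μ f (insert a (insert b S)) x *
        (marginalDensity μ f S x)⁻¹) =ᵐ[Measure.pi μ]
      fun x => marginalDensity μ g (insert a (insert b S)) x * (marginalDensity μ g S x)⁻¹ := by
    rw [Finset.insert_comm]
    exact (condDensity_mul hμ hf a b S).symm.trans ((h₁.mul h₂).trans (condDensity_mul hμ hg a b S))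
  have hm : ∀ {f}, f ∈ PositiveDensities μ → Measurable fun x =>
      marginalDensity μ f (insert a (insert b S)) x * (marginalDensity μ f S x)⁻¹ := fun hf =>
    (measurable_marginalDensity hf.1 _).mul (measurable_marginalDensity hf.1 _).inv
  have hmarg : ∀ {f}, f ∈ PositiveDensities μ → lmarginal μ {a} (fun x =>
      marginalDensity μ f (insert a (insert b S)) x * (marginalDensity μ f S x)⁻¹) =
        condDensity μ f b S := by
    intro f hf
    ext x
    rw [lmarginal_mul_right (g := fun x => (marginalDensity μ f S x)⁻¹)
      (measurable_marginalDensity hf.1 _) (fun x y => by rw [marginalDensity_update ha]),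
      lmarginal_marginalDensity hf.1 (by simp [hab, ha])]
    rfl
  have hb' : condDensity μ f b S =ᵐ[Measure.pi μ] condDensity μ g b S := by
    have := lmarginal_congr_ae (hm hf) (hm hg) hjoint {a}
    rwa [hmarg hf, hmarg hg] at this
  refine ⟨hb', ?_⟩
  filter_upwards [hb', hjoint, ae_marginalDensity hμ hf S, ae_marginalDensity hμ hg S,
    ae_marginalDensity hμ hf (insert b S), ae_marginalDensity hμ hg (insert b S)]
    with x h₁ h₂ hf₁ hg₁ hf₂ hg₂
  have key : ∀ {u v w : ℝ≥0∞}, w ≠ 0 → w ≠ ∞ → v ≠ 0 → v ≠ ∞ → u / v = u * w⁻¹ / (v / w) := by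
    intro u v w h₁ h₂ h₃ h₄
    rw [div_eq_mul_inv v w, ENNReal.mul_div_mul_right _ _ (ENNReal.inv_ne_zero.2 h₂)
      (ENNReal.inv_ne_top.2 h₁)]
  simp only [condDensity] at h₁ ⊢
  rw [key hf₁.1 hf₁.2 hf₂.1 hf₂.2, key hg₁.1 hg₁.2 hg₂.1 hg₂.2, h₂, h₁]

end Marginals

/-! ### Graphical equivalence implies interventional equivalence. -/

namespace MixedGraph

variable {p : ℕ} {X : Fin p → Type*} [∀ i, MeasurableSpace (X i)]
  {μ : ∀ i, Measure (X i)} [∀ i, SigmaFinite (μ i)] {f g : (∀ i, X i) → ℝ≥0∞}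
  {S : Finset (Fin p)} {D : MixedGraph p} {a b : Fin p} {ι : Type*} {T : ι → Finset (Fin p)}

theorem IsDAG.intervene (hD : D.IsDAG) (I : Finset (Fin p)) : (D.intervene I).IsDAG :=
  ⟨fun _ _ h => ⟨h, fun h' => hD.asymm h.1 h'.1⟩,
    fun a h => hD.2 a (Relation.TransGen.mono (fun _ _ h => h.1) _ _ h)⟩

theorem flip_intervene_of_mem (hab : a ≠ b) {I : Finset (Fin p)} (ha : a ∈ I) (hb : b ∈ I) :
    (D.flip a b hab).intervene I = D.intervene I := by
  ext x y
  simp only [flip, MixedGraph.intervene]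
  constructor
  · rintro ⟨h | ⟨rfl, rfl⟩, hy⟩
    · exact ⟨h.1, hy⟩
    · exact absurd ha hy
  · rintro ⟨h, hy⟩
    refine ⟨Or.inl ⟨h, ?_⟩, hy⟩
    rintro ⟨rfl, rfl⟩
    exact hy hb

theorem flip_intervene_of_notMem (hab : a ≠ b) {I : Finset (Fin p)} (ha : a ∉ I) :
    (D.flip a b hab).intervene I = (D.intervene I).flip a b hab := by
  ext x y
  simp only [flip, MixedGraph.intervene]
  constructor
  · rintro ⟨h | h, hy⟩
    · exact Or.inl ⟨⟨h.1, hy⟩, h.2⟩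
    · exact Or.inr h
  · rintro (h | ⟨rfl, rfl⟩)
    · exact ⟨Or.inl ⟨h.1.1, h.2⟩, h.1.2⟩
    · exact ⟨Or.inr ⟨rfl, rfl⟩, ha⟩

theorem Covered.intervene (h : D.Covered a b) {I : Finset (Fin p)} (ha : a ∉ I) (hb : b ∉ I) :
    (D.intervene I).Covered a b :=
  ⟨⟨h.1, hb⟩, fun c hc => by simp [MixedGraph.intervene, ha, hb, h.2 c hc]⟩

theorem Covered.parents_eq (hD : D.IsDAG) (h : D.Covered a b) :
    D.parents b = insert a (D.parents a) := by
  ext c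
  rw [Finset.mem_insert, hD.mem_parents, hD.mem_parents]
  by_cases hc : c = a
  · subst hc; simp [h.1]
  · simp [hc, h.2 c hc]

theorem Covered.parents_flip (hD : D.IsDAG) (h : D.Covered a b) (hab : a ≠ b) :
    (D.flip a b hab).parents b = D.parents a ∧
    (D.flip a b hab).parents a = insert b (D.parents a) ∧
    ∀ c, c ≠ a → c ≠ b → (D.flip a b hab).parents c = D.parents c := by
  have hD' := h.isDAG_flip hD hab
  refine ⟨?_, ?_, fun c hca hcb => ?_⟩ <;> ext x
  · rw [hD'.mem_parents, hD.mem_parents]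
    by_cases hx : x = a
    · subst hx
      simpa [flip, hab] using fun h => D.ne_of_edge x x h rfl
    · simp [flip, hab.symm, hx, h.2 x hx]
  · rw [Finset.mem_insert, hD'.mem_parents, hD.mem_parents]
    simp [flip, hab, or_comm]
  · rw [hD'.mem_parents, hD.mem_parents]
    simp [flip, hca, hcb]

/-- Only the factors of `a` and `b` change, and their product is the chain rule read in the two
orders. -/
theorem Covered.markovDensities_flip (hμ : ∀ i, μ i ≠ 0) (hD : D.IsDAG) (h : D.Covered a b)
    (hab : a ≠ b) : MarkovDensities μ (D.flip a b hab) = MarkovDensities μ D := by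
  obtain ⟨hb, ha, hc⟩ := h.parents_flip hD hab
  ext f
  refine and_congr_right fun hf => ?_
  have hprod : (fun x => ∏ c, condDensity μ f c ((D.flip a b hab).parents c) x)
      =ᵐ[Measure.pi μ] fun x => ∏ c, condDensity μ f c (D.parents c) x := by
    filter_upwards [condDensity_mul_comm hμ hf a b (D.parents a)] with x hx
    have hmem : b ∈ Finset.univ.erase a := by simp [hab.symm]
    rw [← Finset.mul_prod_erase _ _ (Finset.mem_univ a), ← Finset.mul_prod_erase _ _ hmem,
      ← Finset.mul_prod_erase Finset.univ _ (Finset.mem_univ a), ← Finset.mul_prod_erase _ _ hmem,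
      ← mul_assoc, ← mul_assoc, ha, hb, h.parents_eq hD, hx, mul_comm (condDensity μ f b _ x)]
    congr 1
    refine Finset.prod_congr rfl fun c hc' => ?_
    simp only [Finset.mem_erase] at hc'
    rw [hc c hc'.2.1 hc'.1]
  exact ⟨fun h => h.trans hprod, fun h => h.trans hprod.symm⟩

/-- A target contains both ends, and then the intervention graphs coincide, or neither, and then the
arrow stays covered. The invariance of the conditionals at `a` and `b` passes between the two orders
by `condDensity_swap`. -/
theorem Covered.interventionalDensities_flip (hμ : ∀ i, μ i ≠ 0) (hD : D.IsDAG)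
    (h : D.Covered a b) (hab : a ≠ b) (hT : ∀ j, a ∈ T j ↔ b ∈ T j) :
    InterventionalDensities μ T (D.flip a b hab) = InterventionalDensities μ T D := by
  obtain ⟨hb, ha, hc⟩ := h.parents_flip hD hab
  have haS : a ∉ D.parents a := fun h' => D.ne_of_edge a a (hD.mem_parents.1 h') rfl
  have hbS : b ∉ D.parents a := fun h' => hD.asymm h.1 (hD.mem_parents.1 h')
  ext f
  have hM : (∀ j, f j ∈ MarkovDensities μ ((D.flip a b hab).intervene (T j))) ↔
      ∀ j, f j ∈ MarkovDensities μ (D.intervene (T j)) := by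
    refine forall_congr' fun j => ?_
    by_cases haj : a ∈ T j
    · rw [flip_intervene_of_mem hab haj ((hT j).1 haj)]
    · rw [flip_intervene_of_notMem hab haj, (h.intervene haj fun hb => haj ((hT j).2 hb))
        |>.markovDensities_flip hμ (hD.intervene _)]
  refine (and_congr_left' hM).trans (and_congr_right fun hf => ?_)
  refine forall_congr' fun j => forall_congr' fun k => ?_
  have hjk : a ∈ T j ∪ T k ↔ b ∈ T j ∪ T k := by simp [hT]
  by_cases hajk : a ∈ T j ∪ T k
  · refine forall_congr' fun c => imp_congr_right fun hcjk => ?_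
    rw [hc c (by rintro rfl; exact hcjk hajk) (by rintro rfl; exact hcjk (hjk.1 hajk))]
  have hbjk := fun h' => hajk (hjk.2 h')
  constructor
  · intro h' c hcjk
    have h₁ := h' b hbjk
    have h₂ := h' a hajk
    rw [hb] at h₁
    rw [ha] at h₂
    have := condDensity_swap hμ (hf j).1 (hf k).1 hab.symm hbS h₁ h₂
    by_cases hca : c = a
    · exact hca ▸ this.1
    by_cases hcb : c = b
    · rw [hcb, h.parents_eq hD]
      exact this.2
    rw [← hc c hca hcb]
    exact h' c hcjk
  · intro h' c hcjk
    have h₁ := h' a hajk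
    have h₂ := h' b hbjk
    rw [h.parents_eq hD] at h₂
    have := condDensity_swap hμ (hf j).1 (hf k).1 hab haS h₁ h₂
    by_cases hca : c = a
    · rw [hca, ha]
      exact this.2
    by_cases hcb : c = b
    · rw [hcb, hb]
      exact this.1
    rw [hc c hca hcb]
    exact h' c hcjk

/-- Graphically equivalent DAGs are interventionally Markov equivalent. -/
theorem GraphEquivalent.interventionallyEquivalent {D₁ D₂ : MixedGraph p} (hμ : ∀ i, μ i ≠ 0)
    (h₁ : D₁.IsDAG) (h₂ : D₂.IsDAG) (h : GraphEquivalent T D₁ D₂) :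
    InterventionallyEquivalent μ T D₁ D₂ :=
  h.induction (P := fun D => InterventionallyEquivalent μ T D D₂)
    (fun _ _ _ hab hD hc hT h => (hc.interventionalDensities_flip hμ hD hab hT).symm.trans h)
    h₁ h₂ rfl

end MixedGraph

/-! ### Balanced densities. -/

/-- A strictly positive probability density, and a measurable set of probability one half. -/
structure BalancedDensity {α : Type*} [MeasurableSpace α] (μ : Measure α) where
  density : α → ℝ≥0∞
  side : Set α
  measurable_density : Measurable density
  measurableSet_side : MeasurableSet side
  pos : ∀ x, 0 < density x
  lt_top : ∀ x, density x < ∞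
  lintegral_side : ∫⁻ x in side, density x ∂μ = 2⁻¹
  lintegral_side_compl : ∫⁻ x in sideᶜ, density x ∂μ = 2⁻¹

-- A positive integrable weight is rescaled separately on `A` and on its complement, so that each
-- receives mass one half.
open Classical in
theorem BalancedDensity.nonempty {α : Type*} [MeasurableSpace α] {μ : Measure α} [SigmaFinite μ]
    {A : Set α} (hA : MeasurableSet A) (h : μ A ≠ 0) (h' : μ Aᶜ ≠ 0) :
    Nonempty (BalancedDensity μ) := by
  obtain ⟨w, hpos, hw, hint⟩ := exists_pos_lintegral_lt_of_sigmaFinite μ (one_ne_zero (α := ℝ≥0∞))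
  have hne : ∀ s : Set α, MeasurableSet s → μ s ≠ 0 → ∫⁻ x in s, w x ∂μ ≠ 0 := by
    intro s hs h0 h
    rw [lintegral_eq_zero_iff hw.coe_nnreal_ennreal] at h
    have : μ.restrict s = 0 := by
      rw [← ae_eq_bot, ← Filter.empty_mem_iff_bot]
      filter_upwards [h] with x hx
      exact (hpos x).ne' (by simpa using hx)
    exact h0 (Measure.restrict_eq_zero.1 this)
  have htop : ∀ s : Set α, ∫⁻ x in s, w x ∂μ ≠ ∞ := fun s =>
    ((setLIntegral_le_lintegral s _).trans_lt (hint.trans ENNReal.one_lt_top)).ne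
  have hscale : ∀ m : ℝ≥0∞, m ≠ 0 → m ≠ ∞ → m * (2 * m)⁻¹ = 2⁻¹ := by
    intro m h₀ h
    rw [ENNReal.mul_inv (by simp) (by simp), mul_left_comm, ENNReal.mul_inv_cancel h₀ h, mul_one]
  let d : α → ℝ≥0∞ := fun x => w x * if x ∈ A then (2 * ∫⁻ x in A, w x ∂μ)⁻¹ else
    (2 * ∫⁻ x in Aᶜ, w x ∂μ)⁻¹
  have hAw := hne A hA h
  have hAw' := hne Aᶜ hA.compl h'
  refine ⟨⟨d, A, hw.coe_nnreal_ennreal.mul (.ite hA measurable_const measurable_const), hA,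
    fun x => ?_, fun x => ?_, ?_, ?_⟩⟩
  · refine ENNReal.mul_pos (by simpa using (hpos x).ne') ?_
    split_ifs
    · exact ENNReal.inv_ne_zero.2 (ENNReal.mul_ne_top (by simp) (htop _))
    · exact ENNReal.inv_ne_zero.2 (ENNReal.mul_ne_top (by simp) (htop _))
  · refine ENNReal.mul_lt_top (by simp) (lt_top_iff_ne_top.2 ?_)
    split_ifs
    · exact ENNReal.inv_ne_top.2 (mul_ne_zero (by simp) hAw)
    · exact ENNReal.inv_ne_top.2 (mul_ne_zero (by simp) hAw')
  · rw [setLIntegral_congr_fun hA (g := fun x => w x * (2 * ∫⁻ x in A, w x ∂μ)⁻¹)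
      fun x hx => by simp [d, hx], lintegral_mul_const _ hw.coe_nnreal_ennreal, hscale _ hAw (htop _)]
  · rw [setLIntegral_congr_fun hA.compl (g := fun x => w x * (2 * ∫⁻ x in Aᶜ, w x ∂μ)⁻¹)
      fun x hx => by simp only [d, if_neg (show x ∉ A from hx)],
      lintegral_mul_const _ hw.coe_nnreal_ennreal, hscale _ hAw' (htop _)]

theorem BalancedDensity.ne_zero {α : Type*} [MeasurableSpace α] {μ : Measure α}
    (B : BalancedDensity μ) : μ ≠ 0 := by
  rintro rfl
  have := B.lintegral_side
  simp only [Measure.restrict_zero, lintegral_zero_measure] at this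
  exact (ENNReal.inv_ne_zero.2 ENNReal.ofNat_ne_top) this.symm

theorem BalancedDensity.nonempty_type {α : Type*} [MeasurableSpace α] {μ : Measure α}
    (B : BalancedDensity μ) : Nonempty α := by
  by_contra h
  rw [not_nonempty_iff] at h
  exact B.ne_zero μ.eq_zero_of_isEmpty

/-! ### Parity densities: interventional equivalence implies graphical equivalence. -/

section Parity

variable {p : ℕ} {X : Fin p → Type*} [∀ i, MeasurableSpace (X i)]
  {μ : ∀ i, Measure (X i)} (B : ∀ i, BalancedDensity (μ i)) {u v : ℝ≥0∞} {Q : Finset (Fin p)}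
  {a c : Fin p}

open Classical in
/-- The weight `u` or `v`, by the parity of the number of indices `i ∈ Q` such that `x i` is outside
the distinguished set. -/
noncomputable def parityWeight (u v : ℝ≥0∞) (Q : Finset (Fin p)) (x : ∀ i, X i) : ℝ≥0∞ :=
  if Even (Q.filter fun i => x i ∉ (B i).side).card then u else v

theorem parityWeight_eq_or (x : ∀ i, X i) :
    parityWeight B u v Q x = u ∨ parityWeight B u v Q x = v := ite_eq_or_eq ..

theorem parityWeight_self (x : ∀ i, X i) : parityWeight B u u Q x = u := ite_self _

theorem parityWeight_add (x : ∀ i, X i) :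
    parityWeight B u v Q x + parityWeight B v u Q x = u + v := by
  unfold parityWeight
  split_ifs
  · rfl
  · exact add_comm v u

theorem measurable_parityWeight : Measurable (parityWeight B u v Q) := by
  classical
  have h : ∀ P : Finset (Fin p),
      MeasurableSet {x : ∀ i, X i | Even (P.filter fun i => x i ∉ (B i).side).card} := by
    intro P
    induction P using Finset.induction_on with
    | empty => simp
    | insert i P hi ih =>
      have hs : MeasurableSet {x : ∀ i, X i | x i ∈ (B i).side} :=
        measurable_pi_apply i (B i).measurableSet_side
      convert (hs.inter ih).union (hs.compl.inter ih.compl) using 1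
      ext x
      by_cases hx : x i ∈ (B i).side
      · simp [Finset.filter_insert, hx]
      · simp [Finset.filter_insert, hx, hi, Nat.even_add_one]
  exact Measurable.ite (h Q) measurable_const measurable_const

open Classical in
theorem parityWeight_update_of_notMem (ha : a ∉ Q) (x : ∀ i, X i) (y : X a) :
    parityWeight B u v Q (Function.update x a y) = parityWeight B u v Q x := by
  have h : Q.filter (fun i => Function.update x a y i ∉ (B i).side) =
      Q.filter fun i => x i ∉ (B i).side := by
    refine Finset.filter_congr fun i hi => ?_
    rw [Function.update_of_ne (by rintro rfl; exact ha hi)]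
  unfold parityWeight
  rw [h]

open Classical in
theorem parityWeight_update_of_mem (ha : a ∈ Q) (x : ∀ i, X i) (y : X a) :
    parityWeight B u v Q (Function.update x a y) =
      if y ∈ (B a).side then parityWeight B u v (Q.erase a) x
      else parityWeight B v u (Q.erase a) x := by
  have h : Q.filter (fun i => Function.update x a y i ∉ (B i).side) =
      if y ∈ (B a).side then (Q.erase a).filter fun i => x i ∉ (B i).side
      else insert a ((Q.erase a).filter fun i => x i ∉ (B i).side) := by
    ext i
    by_cases hi : i = a
    · subst hi
      by_cases hy : y ∈ (B i).side <;> simp [hy, ha]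
    · split_ifs <;> simp [hi]
  unfold parityWeight
  rw [h]
  by_cases hy : y ∈ (B a).side
  · simp [hy]
  · simp only [hy, if_false]
    rw [Finset.card_insert_of_notMem (by simp)]
    simp only [Nat.even_add_one, ite_not]

theorem lintegral_density_mul (P R : ℝ≥0∞) :
    ∫⁻ y, (B a).density y * (open Classical in if y ∈ (B a).side then P else R) ∂μ a =
      2⁻¹ * (P + R) := by
  classical
  rw [← lintegral_add_compl _ (B a).measurableSet_side,
    setLIntegral_congr_fun (B a).measurableSet_side (g := fun y => (B a).density y * P)
      fun y hy => by simp [hy],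
    setLIntegral_congr_fun (B a).measurableSet_side.compl (g := fun y => (B a).density y * R)
      fun y hy => by simp only [if_neg (show y ∉ (B a).side from hy)],
    lintegral_mul_const _ (B a).measurable_density, lintegral_mul_const _ (B a).measurable_density,
    (B a).lintegral_side, (B a).lintegral_side_compl, mul_add]

/-- A coordinate in `Q` exchanges `u` and `v` with probability one half, so averaging over it gives
`(u + v) / 2 = 1`: losing a single coordinate of `Q` erases the interaction. -/
theorem lintegral_density_mul_parityWeight (huv : u + v = 2) (x : ∀ i, X i) :
    ∫⁻ y, (B a).density y * parityWeight B u v Q (Function.update x a y) ∂μ a =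
      if a ∈ Q then 1 else parityWeight B u v Q x := by
  classical
  split_ifs with ha
  · simp only [parityWeight_update_of_mem B ha]
    rw [lintegral_density_mul, parityWeight_add, huv, ENNReal.inv_mul_cancel (by simp) (by simp)]
  · simp only [parityWeight_update_of_notMem B ha]
    have := lintegral_density_mul B (a := a) (parityWeight B u v Q x) (parityWeight B u v Q x)
    simp only [ite_self] at this
    rw [this, ← two_mul, ← mul_assoc, ENNReal.inv_mul_cancel (by simp) (by simp), one_mul]

/-- A product density, perturbed by an interaction of the variables in `Q`. -/
noncomputable def parityDensity (u v : ℝ≥0∞) (Q : Finset (Fin p)) (x : ∀ i, X i) : ℝ≥0∞ :=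
  (∏ i, (B i).density (x i)) * parityWeight B u v Q x

theorem measurable_parityDensity : Measurable (parityDensity B u v Q) :=
  (Finset.measurable_prod _ fun i _ => (B i).measurable_density.comp (measurable_pi_apply i)).mul
    (measurable_parityWeight B)

variable [∀ i, SigmaFinite (μ i)]

open Classical in
theorem lmarginal_parityDensity (huv : u + v = 2) (s : Finset (Fin p)) (x : ∀ i, X i) :
    lmarginal μ s (parityDensity B u v Q) x =
      (∏ i ∈ sᶜ, (B i).density (x i)) * if Disjoint s Q then parityWeight B u v Q x else 1 := by
  induction s using Finset.induction_on generalizing x with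
  | empty => simp [parityDensity]
  | insert a s ha ih =>
    rw [lmarginal_insert _ (measurable_parityDensity B) ha]
    have hs : sᶜ = insert a (insert a s)ᶜ := by
      ext i
      by_cases hi : i = a
      · subst hi; simp [ha]
      · simp [hi]
    have hprod : ∀ y, ∏ i ∈ sᶜ, (B i).density (Function.update x a y i) =
        (∏ i ∈ (insert a s)ᶜ, (B i).density (x i)) * (B a).density y := by
      intro y
      rw [hs, Finset.prod_insert (by simp), Function.update_self, mul_comm]
      congr 1
      refine Finset.prod_congr rfl fun i hi => ?_
      rw [Function.update_of_ne (by rintro rfl; simp at hi)]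
    simp only [ih, hprod, mul_assoc]
    rw [lintegral_const_mul' _ _ (ENNReal.prod_ne_top fun i _ => ((B i).lt_top _).ne)]
    congr 1
    by_cases hsQ : Disjoint s Q
    · simp only [hsQ, if_true, Finset.disjoint_insert_left, and_true]
      rw [lintegral_density_mul_parityWeight B huv]
      by_cases haQ : a ∈ Q <;> simp [haQ]
    · have := lintegral_density_mul B (a := a) 1 1
      simp only [ite_self, mul_one] at this
      simp only [hsQ, if_false, Finset.disjoint_insert_left, and_false, mul_one, this]
      rw [one_add_one_eq_two, ENNReal.inv_mul_cancel (by simp) (by simp)]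

theorem marginalDensity_parityDensity (huv : u + v = 2) (S : Finset (Fin p)) (x : ∀ i, X i) :
    marginalDensity μ (parityDensity B u v Q) S x =
      (∏ i ∈ S, (B i).density (x i)) * if Q ⊆ S then parityWeight B u v Q x else 1 := by
  classical
  change lmarginal μ Sᶜ _ x = _
  rw [lmarginal_parityDensity B huv, compl_compl]
  congr 2
  rw [disjoint_comm, disjoint_compl_right_iff]

/-- The weight shows only in marginals that retain all of `Q`. It survives in the quotient exactly
when `a` completes `Q`; if `Q ⊆ S` it cancels. -/
theorem condDensity_parityDensity (huv : u + v = 2) (hu : u ≠ 0) (hv : v ≠ 0)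
    (S : Finset (Fin p)) (ha : a ∉ S) (x : ∀ i, X i) :
    condDensity μ (parityDensity B u v Q) a S x =
      (B a).density (x a) * if a ∈ Q ∧ Q ⊆ insert a S then parityWeight B u v Q x else 1 := by
  have hu' : u ≠ ∞ := by rintro rfl; simp at huv
  have hv' : v ≠ ∞ := by rintro rfl; simp at huv
  have hw : parityWeight B u v Q x ≠ 0 ∧ parityWeight B u v Q x ≠ ∞ := by
    rcases parityWeight_eq_or B (u := u) (v := v) (Q := Q) x with h | h <;> rw [h]
    exacts [⟨hu, hu'⟩, ⟨hv, hv'⟩]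
  have hP : ∏ i ∈ S, (B i).density (x i) ≠ 0 := Finset.prod_ne_zero_iff.2 fun i _ =>
    ((B i).pos _).ne'
  have hP' : ∏ i ∈ S, (B i).density (x i) ≠ ∞ := ENNReal.prod_ne_top fun i _ =>
    ((B i).lt_top _).ne
  rw [condDensity, marginalDensity_parityDensity B huv, marginalDensity_parityDensity B huv,
    Finset.prod_insert ha]
  have hcancel : ∀ {P d w r : ℝ≥0∞}, P ≠ 0 → P ≠ ∞ → d * P * w / (P * r) = d * (w / r) := by
    intro P d w r h₀ h
    rw [mul_comm d P, mul_assoc, ENNReal.mul_div_mul_left _ _ h₀ h, mul_div_assoc]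
  rw [hcancel hP hP']
  congr 1
  by_cases hQS : Q ⊆ S
  · have : a ∉ Q := fun h => ha (hQS h)
    simp [hQS, hQS.trans (Finset.subset_insert a S), this, ENNReal.div_self hw.1 hw.2]
  by_cases hQ : Q ⊆ insert a S
  · have : a ∈ Q := by
      by_contra h
      exact hQS ((Finset.subset_insert_iff_of_notMem h).1 hQ)
    simp [hQS, hQ, this]
  · simp [hQS, hQ]

theorem parityDensity_mem_positiveDensities (huv : u + v = 2) (hu : u ≠ 0) (hv : v ≠ 0)
    (hQ : Q.Nonempty) : parityDensity B u v Q ∈ PositiveDensities μ := by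
  have hu' : u ≠ ∞ := by rintro rfl; simp at huv
  have hv' : v ≠ ∞ := by rintro rfl; simp at huv
  refine ⟨measurable_parityDensity B, fun x => ?_, ?_⟩
  · have hw : parityWeight B u v Q x ≠ 0 ∧ parityWeight B u v Q x ≠ ∞ := by
      rcases parityWeight_eq_or B (u := u) (v := v) (Q := Q) x with h | h <;> rw [h]
      exacts [⟨hu, hu'⟩, ⟨hv, hv'⟩]
    refine ⟨ENNReal.mul_pos (Finset.prod_ne_zero_iff.2 fun i _ => ((B i).pos _).ne') hw.1,
      ENNReal.mul_lt_top (ENNReal.prod_lt_top fun i _ => (B i).lt_top _) hw.2.lt_top⟩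
  · have (i : Fin p) : Nonempty (X i) := (B i).nonempty_type
    rw [lintegral_eq_lmarginal_univ (fun i => Classical.arbitrary (X i)),
      lmarginal_parityDensity B huv]
    have : ¬ Disjoint Finset.univ Q := by
      obtain ⟨i, hi⟩ := hQ
      exact fun h => Finset.disjoint_left.1 h (Finset.mem_univ i) hi
    simp [this]

open MixedGraph

theorem MixedGraph.notMem_parents_self (D : MixedGraph p) : a ∉ D.parents a := by
  simpa [parents] using fun h : D.Arrow a a => h.ne rfl

/-- The tuple of parity densities with the interaction of `Q` switched off by the targets that
contain `c`. -/
noncomputable def parityTuple {ι : Type*} (T : ι → Finset (Fin p)) (c : Fin p)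
    (Q : Finset (Fin p)) (j : ι) : (∀ i, X i) → ℝ≥0∞ :=
  -- Equal weights `1` give the product density. For `3 / 2` and `1 / 2` it matters only that they
  -- are positive, sum to `2` and differ from `1`.
  if c ∈ T j then parityDensity B 1 1 Q else parityDensity B (3 / 2) (1 / 2) Q

theorem ENNReal.three_halves_add_half : (3 / 2 : ℝ≥0∞) + 1 / 2 = 2 := by
  rw [ENNReal.div_add_div_same, show (3 + 1 : ℝ≥0∞) = 2 * 2 by norm_num, mul_div_assoc,
    ENNReal.div_self (by simp) (by simp), mul_one]

theorem prod_condDensity_parityDensity (huv : u + v = 2) (hu : u ≠ 0) (hv : v ≠ 0)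
    (D : MixedGraph p) (x : ∀ i, X i) :
    ∏ a, condDensity μ (parityDensity B u v Q) a (D.parents a) x =
      (∏ a, (B a).density (x a)) *
        ∏ a, if a ∈ Q ∧ Q ⊆ insert a (D.parents a) then parityWeight B u v Q x else 1 := by
  rw [← Finset.prod_mul_distrib]
  refine Finset.prod_congr rfl fun a _ => condDensity_parityDensity B huv hu hv _
    D.notMem_parents_self x

variable {ι : Type*} {T : ι → Finset (Fin p)} {D D₁ D₂ : MixedGraph p}

/-- Two such vertices would be parents of each other. Hence the parity weight appears in at most one
factor of the Markov factorization. -/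
theorem MixedGraph.IsDAG.eq_of_subset_insert_parents (hD : D.IsDAG) (hc : c ∈ Q)
    (hQ : Q ⊆ insert c (D.parents c)) (ha : a ∈ Q) {I : Finset (Fin p)}
    (hQ' : Q ⊆ insert a ((D.intervene I).parents a)) : a = c := by
  by_contra hne
  have h₁ := (Finset.mem_insert.1 (hQ ha)).resolve_left hne
  have h₂ := (Finset.mem_insert.1 (hQ' hc)).resolve_left (Ne.symm hne)
  rw [hD.mem_parents] at h₁
  rw [(hD.intervene I).mem_parents] at h₂
  exact hD.asymm h₁ h₂.1

/-- The interaction sits in the conditional of `c` alone, which a target containing `c` is free to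
change; all other conditionals are the same product factors for every target. -/
theorem parityTuple_mem_interventionalDensities (hD : D.IsDAG) (hc : c ∈ Q)
    (hQ : Q ⊆ insert c (D.parents c)) :
    parityTuple B T c Q ∈ InterventionalDensities μ T D := by
  have h₃ : (3 / 2 : ℝ≥0∞) ≠ 0 := by simp
  have h₁ : (1 / 2 : ℝ≥0∞) ≠ 0 := by simp
  refine ⟨fun j => ?_, fun j k a ha => ?_⟩
  · unfold parityTuple
    split_ifs with hcj
    · refine ⟨parityDensity_mem_positiveDensities B one_add_one_eq_two one_ne_zero one_ne_zero
        ⟨c, hc⟩, .of_forall fun x => ?_⟩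
      dsimp only
      rw [prod_condDensity_parityDensity B one_add_one_eq_two one_ne_zero one_ne_zero]
      simp [parityDensity, parityWeight_self]
    · refine ⟨parityDensity_mem_positiveDensities B ENNReal.three_halves_add_half h₃ h₁
        ⟨c, hc⟩, .of_forall fun x => ?_⟩
      dsimp only
      rw [prod_condDensity_parityDensity B ENNReal.three_halves_add_half h₃ h₁, parityDensity,
        Finset.prod_eq_single (M := ℝ≥0∞) (f := fun a => if a ∈ Q ∧
          Q ⊆ insert a ((D.intervene (T j)).parents a) then _ else _) c]
      · have : (D.intervene (T j)).parents c = D.parents c := by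
          ext i
          rw [hD.mem_parents, (hD.intervene _).mem_parents]
          simp [MixedGraph.intervene, hcj]
        rw [this, if_pos ⟨hc, hQ⟩]
      · intro a _ hac
        exact if_neg fun h => hac (hD.eq_of_subset_insert_parents hc hQ h.1 h.2)
      · simp
  · by_cases hac : a = c
    · subst hac
      simp only [Finset.mem_union, not_or] at ha
      simp [parityTuple, ha]
    · have hcond : ∀ j, condDensity μ (parityTuple B T c Q j) a (D.parents a) =
          fun x => (B a).density (x a) := by
        intro j
        have ha' := D.notMem_parents_self (a := a)
        have hI : D.intervene ∅ = D := by ext; simp [MixedGraph.intervene]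
        ext x
        unfold parityTuple
        split_ifs
        · rw [condDensity_parityDensity B one_add_one_eq_two one_ne_zero one_ne_zero _ ha']
          simp [parityWeight_self]
        · rw [condDensity_parityDensity B ENNReal.three_halves_add_half h₃ h₁ _ ha',
            if_neg, mul_one]
          refine fun h => hac (hD.eq_of_subset_insert_parents (I := ∅) hc hQ h.1 ?_)
          rw [hI]
          exact h.2
      rw [hcond, hcond]

/-- Otherwise no factor sees the interaction and the weight would equal `1` somewhere. -/
theorem exists_subset_insert_parents
    (h : parityDensity B (3 / 2) (1 / 2) Q ∈ MarkovDensities μ D) :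
    ∃ a ∈ Q, Q ⊆ insert a (D.parents a) := by
  by_contra! hn
  have h' := h.2
  have hpi : Measure.pi μ ≠ 0 := by
    intro h0
    have := congrArg (fun m => m Set.univ) h0
    simp only [Measure.pi_univ, Measure.coe_zero, Pi.zero_apply, Finset.prod_eq_zero_iff,
      Measure.measure_univ_eq_zero] at this
    obtain ⟨i, -, hi⟩ := this
    exact (B i).ne_zero hi
  have := ae_neBot.2 hpi
  obtain ⟨x, hx⟩ := h'.exists
  dsimp only at hx
  rw [prod_condDensity_parityDensity B ENNReal.three_halves_add_half (by simp) (by simp),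
    Finset.prod_eq_one fun a _ => if_neg fun h => hn a h.1 h.2, parityDensity,
    ENNReal.mul_right_inj (Finset.prod_ne_zero_iff.2 fun i _ => ((B i).pos _).ne')
      (ENNReal.prod_ne_top fun i _ => ((B i).lt_top _).ne)] at hx
  rcases parityWeight_eq_or B (u := 3 / 2) (v := 1 / 2) (Q := Q) x with h | h <;> rw [h] at hx
  · rw [ENNReal.div_eq_one_iff (by simp) (by simp)] at hx
    norm_num at hx
  · simp at hx

/-- This transports parent sets between equivalent DAGs: two-element `Q` carry edges, three-element
`Q` carry v-structures. -/
theorem InterventionallyEquivalent.exists_subset_insert_parents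
    (B : ∀ i, BalancedDensity (μ i))
    (h : InterventionallyEquivalent μ T D₁ D₂) (h₁ : D₁.IsDAG) (hc : c ∈ Q)
    (hQ : Q ⊆ insert c (D₁.parents c)) {j : ι} (hj : c ∉ T j) :
    ∃ a ∈ Q, Q ⊆ insert a ((D₂.intervene (T j)).parents a) := by
  have hmem := parityTuple_mem_interventionalDensities B (T := T) h₁ hc hQ
  rw [show InterventionalDensities μ T D₁ = _ from h] at hmem
  have := hmem.1 j
  rw [parityTuple, if_neg hj] at this
  exact _root_.exists_subset_insert_parents B this

theorem InterventionallyEquivalent.adjacent_intervene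
    (B : ∀ i, BalancedDensity (μ i))
    (h : InterventionallyEquivalent μ T D₁ D₂) (h₁ : D₁.IsDAG) (h₂ : D₂.IsDAG) {b : Fin p}
    (hab : D₁.Edge a b) {j : ι} (hj : b ∉ T j) : (D₂.intervene (T j)).Adjacent a b := by
  have hne := D₁.ne_of_edge _ _ hab
  obtain ⟨c, hc, hQ⟩ := InterventionallyEquivalent.exists_subset_insert_parents B h h₁ (Q := {a, b}) (c := b) (by simp)
    (by simp [Finset.insert_subset_iff, h₁.mem_parents, hab]) hj
  rw [Finset.mem_insert, Finset.mem_singleton] at hc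
  rcases hc with rfl | rfl
  · have : b ∈ (D₂.intervene (T j)).parents c :=
      (Finset.mem_insert.1 (hQ (by simp))).resolve_left hne.symm
    exact Or.inr ((h₂.intervene _).mem_parents.1 this)
  · have : a ∈ (D₂.intervene (T j)).parents c :=
      (Finset.mem_insert.1 (hQ (by simp))).resolve_left hne
    exact Or.inl ((h₂.intervene _).mem_parents.1 this)

theorem InterventionallyEquivalent.graphEquivalent (hT : IsConservative T)
    (B : ∀ i, BalancedDensity (μ i))
    (h : InterventionallyEquivalent μ T D₁ D₂) (h₁ : D₁.IsDAG) (h₂ : D₂.IsDAG) :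
    GraphEquivalent T D₁ D₂ := by
  have hadj : ∀ {D₁ D₂ : MixedGraph p}, InterventionallyEquivalent μ T D₁ D₂ → D₁.IsDAG →
      D₂.IsDAG → ∀ {a b}, D₁.Adjacent a b → D₂.Adjacent a b := by
    intro D₁ D₂ h h₁ h₂
    have key : ∀ {a b}, D₁.Edge a b → D₂.Adjacent a b := by
      intro a b hab
      obtain ⟨j, hj⟩ := hT b
      exact (InterventionallyEquivalent.adjacent_intervene B h h₁ h₂ hab hj).imp And.left And.left
    rintro a b (hab | hba)
    exacts [key hab, (key hba).symm]
  have hv : ∀ {D₁ D₂ : MixedGraph p}, InterventionallyEquivalent μ T D₁ D₂ → D₁.IsDAG →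
      D₂.IsDAG → ∀ {a b c}, D₁.VStructure a b c → D₂.VStructure a b c := by
    rintro D₁ D₂ h h₁ h₂ a b c ⟨hab, hcb, hac, hn⟩
    obtain ⟨j, hj⟩ := hT b
    have hab' := D₁.ne_of_edge _ _ hab
    have hcb' := D₁.ne_of_edge _ _ hcb
    have hn' : ¬ D₂.Adjacent a c := fun h' => hn (hadj h.symm h₂ h₁ h')
    obtain ⟨d, hd, hQ⟩ := InterventionallyEquivalent.exists_subset_insert_parents B h h₁ (Q := {a, b, c}) (c := b) (by simp)
      (by simp [Finset.insert_subset_iff, h₁.mem_parents, hab, hcb]) hj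
    have hedge : ∀ x ∈ ({a, b, c} : Finset (Fin p)), x ≠ d → D₂.Edge x d := fun x hx hxd =>
      ((h₂.intervene _).mem_parents.1 ((Finset.mem_insert.1 (hQ hx)).resolve_left hxd)).1
    simp only [Finset.mem_insert, Finset.mem_singleton] at hd
    rcases hd with rfl | rfl | rfl
    · exact absurd (Or.inr (hedge c (by simp) hac.symm)) hn'
    · exact ⟨hedge a (by simp) hab', hedge c (by simp) hcb', hac, hn'⟩
    · exact absurd (Or.inl (hedge a (by simp) hac)) hn'
  refine ⟨fun a b => ⟨hadj h h₁ h₂, hadj h.symm h₂ h₁⟩,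
    fun a b c => ⟨hv h h₁ h₂, hv h.symm h₂ h₁⟩, fun j a b hj hab => ?_⟩
  -- The target contains one end only. Adjacency survives the intervention when the head of the edge
  -- is outside the target, and then no edge can point to the end inside. For `b` inside, this is
  -- applied to a supposed edge `b → a` of `D₂`.
  by_cases hb : b ∈ T j
  · have ha : a ∉ T j := fun ha => hj (by simp [ha, hb])
    refine (hadj h h₁ h₂ (Or.inl hab)).resolve_right fun hba => ?_
    rcases InterventionallyEquivalent.adjacent_intervene B h.symm h₂ h₁ hba ha with h' | h'
    · exact h₁.asymm hab h'.1
    · exact h'.2 hb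
  · rcases InterventionallyEquivalent.adjacent_intervene B h h₁ h₂ hab hb with h' | h'
    · exact h'.1
    · exact absurd (by simp [h'.2, hb]) hj

end Parity

/-! ### The union of an equivalence class, and the graphs between `D` and it. -/

namespace MixedGraph

variable {p : ℕ} {ι : Type*} {T : ι → Finset (Fin p)} {D E G H : MixedGraph p} {a b c : Fin p}

theorem card_inter_pair_eq_one (hab : a ≠ b) (s : Finset (Fin p)) :
    (s ∩ {a, b}).card = 1 ↔ ¬ (a ∈ s ↔ b ∈ s) := by
  by_cases ha : a ∈ s <;> by_cases hb : b ∈ s <;>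
    simp [Finset.inter_insert_of_mem, Finset.inter_insert_of_notMem,
      Finset.inter_singleton_of_mem, Finset.inter_singleton_of_notMem, ha, hb, hab]

/-- `E` is the union of all DAGs which are graphically equivalent to `D`. -/
def IsEquivalenceUnion (T : ι → Finset (Fin p)) (D E : MixedGraph p) : Prop :=
  ∀ a b, E.Edge a b ↔ ∃ D' : MixedGraph p, D'.IsDAG ∧ GraphEquivalent T D' D ∧ D'.Edge a b

namespace IsEquivalenceUnion

theorem le (hE : IsEquivalenceUnion T D E) (hD : D.IsDAG) : D ≤ E := fun _ _ h =>
  (hE _ _).2 ⟨D, hD, .refl, h⟩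

theorem adjacent_iff (hE : IsEquivalenceUnion T D E) (hD : D.IsDAG) :
    E.Adjacent a b ↔ D.Adjacent a b := by
  refine ⟨?_, fun h => h.imp (hE.le hD _ _) (hE.le hD _ _)⟩
  rintro (h | h) <;> obtain ⟨D', -, he, h'⟩ := (hE _ _).1 h
  exacts [(he.1 _ _).1 (Or.inl h'), (he.1 _ _).1 (Or.inr h')]

theorem arrow_of_forall (hE : IsEquivalenceUnion T D E) (hD : D.IsDAG)
    (h : ∀ D' : MixedGraph p, D'.IsDAG → GraphEquivalent T D' D → D'.Edge a b) : E.Arrow a b := by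
  refine ⟨hE.le hD _ _ (h D hD .refl), fun hba => ?_⟩
  obtain ⟨D', hD', he, hba⟩ := (hE _ _).1 hba
  exact hD'.asymm (h D' hD' he) hba

theorem edge_of_arrow (hE : IsEquivalenceUnion T D E) {D' : MixedGraph p} (hD : D.IsDAG)
    (h : E.Arrow a b) (hD' : D'.IsDAG) (he : GraphEquivalent T D' D) : D'.Edge a b := by
  have := (he.1 a b).2 ((hE.adjacent_iff hD).1 (Or.inl h.1))
  exact this.resolve_right fun hba => h.2 ((hE _ _).2 ⟨D', hD', he, hba⟩)

theorem arrow_of_vStructure (hE : IsEquivalenceUnion T D E) (hD : D.IsDAG)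
    (h : D.VStructure a b c) : E.Arrow a b :=
  hE.arrow_of_forall hD fun _ _ he => ((he.2 _ _ _).2 h).1

theorem arrow_of_target (hE : IsEquivalenceUnion T D E) (hD : D.IsDAG) {j : ι}
    (hj : ¬ (a ∈ T j ↔ b ∈ T j)) (h : D.Edge a b) : E.Arrow a b :=
  hE.arrow_of_forall hD fun _ _ he => (he.symm hD).3 j a b hj h

/-- An edge of `D` not reached by the rules is free, so some equivalent DAG reverses it and the
union has a line there. -/
theorem arrow_iff_compelled (hE : IsEquivalenceUnion T D E) (hD : D.IsDAG) :
    E.Arrow a b ↔ Compelled T D a b := by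
  refine ⟨fun h => ?_, fun h => hE.arrow_of_forall hD fun D' hD' he =>
    h.edge_of_graphEquivalent hD hD' (he.symm hD)⟩
  have hab := hE.edge_of_arrow hD h hD .refl
  by_contra hn
  have hfree : Free T D a b := ⟨Or.inl hab, hn, fun h' => hD.asymm hab h'.edge⟩
  obtain ⟨D', hD', he, hba⟩ := hfree.symm.exists_graphEquivalent hD
  exact h.2 ((hE _ _).2 ⟨D', hD', he, hba⟩)

/-- Some equivalent DAG orients the line as `c → b`. Without adjacency this makes a v-structure,
common to the whole class, so `b`, `c` would not form a line. -/
theorem not_induced (hE : IsEquivalenceUnion T D E) (hD : D.IsDAG) (hab : E.Arrow a b)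
    (hbc : E.Line b c) : E.Adjacent a c := by
  by_contra hn
  obtain ⟨D', hD', he, hcb⟩ := (hE _ _).1 hbc.2
  have hac : a ≠ c := by rintro rfl; exact hab.2 hbc.1
  have hv : D'.VStructure a b c := ⟨hE.edge_of_arrow hD hab hD' he, hcb, hac,
    fun h => hn ((hE.adjacent_iff hD).2 ((he.1 _ _).1 h))⟩
  exact (hE.arrow_of_vStructure hD ((he.2 _ _ _).1 hv).symm).2 hbc.1

/-- All arrows of the union are strongly protected. -/
theorem allArrowsProtected (hE : IsEquivalenceUnion T D E) (hD : D.IsDAG) :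
    AllArrowsProtected T E := by
  intro a b hab
  have hcomp := (hE.arrow_iff_compelled hD).1 hab
  have hC : ∀ {x y}, Compelled T D x y → E.Arrow x y := (hE.arrow_iff_compelled hD).2
  have hadj : ∀ {x y}, E.Adjacent x y ↔ D.Adjacent x y := hE.adjacent_iff hD
  cases hcomp with
  | target j h hj => exact Or.inl ⟨j, (card_inter_pair_eq_one hab.ne _).2 hj⟩
  | @collider _ _ c h =>
    exact Or.inr (Or.inr (Or.inl ⟨c, hC (.collider h.symm), h.2.2.1.symm,
      fun h' => h.2.2.2 (hadj.1 h').symm⟩))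
  | @away _ _ c hca h hcb =>
    refine Or.inr (Or.inl ⟨c, hC hca, ?_, fun h' => hcb (hadj.1 h')⟩)
    rintro rfl
    exact hD.asymm h hca.edge
  | @path _ _ c hac hcb h => exact Or.inr (Or.inr (Or.inr (Or.inl ⟨c, hC hac, hC hcb⟩)))
  | @diamond _ _ c₁ c₂ h₁ h₂ h ha₁ ha₂ hne hn ha =>
    by_cases hc₁ : Compelled T D a c₁
    · exact Or.inr (Or.inr (Or.inr (Or.inl ⟨c₁, hC hc₁, hC h₁⟩)))
    by_cases hc₂ : Compelled T D a c₂
    · exact Or.inr (Or.inr (Or.inr (Or.inl ⟨c₂, hC hc₂, hC h₂⟩)))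
    -- A compelled `c → a` is impossible: as `c` and `d` do not both point to `a`, `D` has `a → d`,
    -- which `away` would compel.
    have hline : ∀ {c d}, D.Adjacent a c → D.Adjacent a d → c ≠ d → ¬ D.Adjacent c d →
        ¬ (D.Edge c a ∧ D.Edge d a) → ¬ Compelled T D a c → ¬ Compelled T D a d →
        E.Line a c := by
      intro c d hac had hcd hn ha hc hd
      have hca : ¬ Compelled T D c a := fun hca =>
        hd (hca.away (had.resolve_right fun h => ha ⟨hca.edge, h⟩) hn)
      rw [← hE.arrow_iff_compelled hD] at hc hca
      rcases hadj.2 hac with h | h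
      · exact ⟨h, not_not.1 fun h' => hc ⟨h, h'⟩⟩
      · exact ⟨not_not.1 fun h' => hca ⟨h, h'⟩, h⟩
    exact Or.inr (Or.inr (Or.inr (Or.inr ⟨c₁, c₂, hline ha₁ ha₂ hne hn ha hc₁ hc₂,
      hline ha₂ ha₁ hne.symm (fun h => hn h.symm) (fun h => ha h.symm) hc₂ hc₁, hC h₁, hC h₂, hne,
      fun h => hn (hadj.1 h)⟩)))

section Intermediate

variable (hE : IsEquivalenceUnion T D E) (hD : D.IsDAG) (hDG : D ≤ G) (hGE : G ≤ E)

include hE hD hDG hGE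

theorem adjacent_iff_of_le : G.Adjacent a b ↔ D.Adjacent a b :=
  ⟨fun h => (hE.adjacent_iff hD).1 (h.imp (hGE _ _) (hGE _ _)), fun h => h.imp (hDG _ _) (hDG _ _)⟩

theorem edge_of_arrow_of_le (h : G.Arrow a b) : D.Edge a b :=
  ((adjacent_iff_of_le hE hD hDG hGE).1 (Or.inl h.1)).resolve_right fun h' => h.2 (hDG _ _ h')

theorem arrow_of_le (h : E.Arrow a b) : G.Arrow a b :=
  ⟨hDG _ _ (hE.edge_of_arrow hD h hD .refl), fun h' => h.2 (hGE _ _ h')⟩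

/-- A partial graph all of whose arrows are strongly protected is the whole union. -/
theorem eq_of_allArrowsProtected (hG : AllArrowsProtected T G) : G = E := by
  obtain ⟨r, hr⟩ := hD.exists_rank
  have hadj : ∀ {x y}, G.Adjacent x y ↔ D.Adjacent x y := adjacent_iff_of_le hE hD hDG hGE
  have hedge : ∀ {x y}, G.Arrow x y → D.Edge x y := edge_of_arrow_of_le hE hD hDG hGE
  have hne : ¬ ∃ a b, G.Arrow a b ∧ E.Edge b a := by
    rintro ⟨a, b, hab, hba⟩
    -- Earliest head, then latest tail: the arrows of `G` with an earlier head, and those into `b`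
    -- with a later tail, are already arrows of `E`.
    obtain ⟨a, b, ⟨hab, hba⟩, hmin, hmax⟩ :=
      exists_min_max (P := fun x y => G.Arrow x y ∧ E.Edge y x) r ⟨hab, hba⟩
    have hagree : ∀ {x y}, r y < r b → G.Arrow x y → E.Arrow x y := fun hy hxy =>
      ⟨hGE _ _ hxy.1, fun hyx => (hmin _ _ ⟨hxy, hyx⟩).not_gt hy⟩
    rcases hG a b hab with ⟨j, hj⟩ | ⟨c, hc, hcb, hn⟩ | ⟨c, hc, hca, hn⟩ | ⟨c, hac, hcb⟩ |
      ⟨c₁, c₂, hl₁, hl₂, h₁, h₂, hne, hn⟩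
    · exact (hE.arrow_of_target hD ((card_inter_pair_eq_one hab.ne _).1 hj) (hedge hab)).2 hba
    · refine hn (hadj.2 ((hE.adjacent_iff hD).1 ?_))
      exact hE.not_induced hD (hagree (hr _ _ (hedge hab)) hc) ⟨hGE _ _ hab.1, hba⟩
    · exact (hE.arrow_of_vStructure hD
        ⟨hedge hab, hedge hc, hca.symm, fun h => hn (hadj.2 h).symm⟩).2 hba
    · obtain ⟨D', hD', he, hba'⟩ := (hE _ _).1 hba
      have hac' := hE.edge_of_arrow hD (hagree (hr _ _ (hedge hcb)) hac) hD' he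
      have hcb' : E.Arrow c b :=
        ⟨hGE _ _ hcb.1, fun h => (hmax c ⟨hcb, h⟩).not_gt (hr _ _ (hedge hac))⟩
      have hcb'' := hE.edge_of_arrow hD hcb' hD' he
      exact hD'.asymm (hD'.edge_trans hac' hcb'' (Or.inr hba')) hba'
    -- In a class member with `b → a`, the v-structure at `b` forces `c₁ → a ← c₂`; this is again a
    -- v-structure, so `E` cannot contain the edge `a → c₁`.
    · obtain ⟨D', hD', he, hba'⟩ := (hE _ _).1 hba
      have hn' : ¬ D.Adjacent c₁ c₂ := fun h => hn (hadj.2 h)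
      have hv : D.VStructure c₁ b c₂ := ⟨hedge h₁, hedge h₂, hne, hn'⟩
      have hv' := (he.2 _ _ _).2 hv
      have hp : ∀ {c}, G.Line a c → D'.Edge c b → D'.Edge c a := fun hl hcb =>
        hD'.edge_trans hcb hba' ((he.1 _ _).2 (hadj.1 (Or.inr hl.1)))
      have := (he.2 c₁ a c₂).1 ⟨hp hl₁ hv'.1, hp hl₂ hv'.2.1, hne, fun h => hn' ((he.1 _ _).1 h)⟩
      exact (hE.arrow_of_vStructure hD this).2 (hGE _ _ hl₁.1)
  ext a b
  refine ⟨hGE a b, fun hab => ?_⟩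
  have := (adjacent_iff_of_le hE hD hDG hGE).2 ((hE.adjacent_iff hD).1 (Or.inl hab))
  by_contra hn
  exact hne ⟨b, a, ⟨this.resolve_left hn, hn⟩, hab⟩

/-- Arrows of the union are strongly protected in the partial graphs too. -/
theorem stronglyProtected_of_arrow
    (hind : ∀ a b c, G.Arrow a b → G.Line b c → G.Adjacent a c) (hab : E.Arrow a b) : StronglyProtected T G a b := by
  have hA : ∀ {x y}, E.Arrow x y → G.Arrow x y := arrow_of_le hE hD hDG hGE
  have hadj : ∀ {x y}, G.Adjacent x y ↔ E.Adjacent x y :=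
    (adjacent_iff_of_le hE hD hDG hGE).trans (hE.adjacent_iff hD).symm
  rcases hE.allArrowsProtected hD a b hab with h | ⟨c, hc, hne, hn⟩ | ⟨c, hc, hne, hn⟩ |
    ⟨c, hc, hc'⟩ | ⟨c₁, c₂, hl₁, hl₂, h₁, h₂, hne, hn⟩
  · exact Or.inl h
  · exact Or.inr (Or.inl ⟨c, hA hc, hne, fun h => hn (hadj.1 h)⟩)
  · exact Or.inr (Or.inr (Or.inl ⟨c, hA hc, hne, fun h => hn (hadj.1 h)⟩))
  · exact Or.inr (Or.inr (Or.inr (Or.inl ⟨c, hA hc, hA hc'⟩)))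
  · by_cases hp₁ : G.Arrow a c₁
    · exact Or.inr (Or.inr (Or.inr (Or.inl ⟨c₁, hp₁, hA h₁⟩)))
    by_cases hp₂ : G.Arrow a c₂
    · exact Or.inr (Or.inr (Or.inr (Or.inl ⟨c₂, hp₂, hA h₂⟩)))
    -- Lines of `E` may be arrows of `G`. An arrow `c → a` of `G` excludes `d → a`, which would make
    -- a v-structure, and leaves the line between `a` and `d`: the forbidden subgraph `c → a - d`.
    have hline : ∀ {c d}, E.Line a c → E.Line a d → c ≠ d → ¬ E.Adjacent c d → ¬ G.Arrow a c →
        ¬ G.Arrow a d → G.Line a c := by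
      intro c d hc hd hne hn hpc hpd
      have hnot : ¬ G.Arrow c a := fun hca => by
        refine hn (hadj.1 (hind c a d hca ?_))
        have hda : ¬ G.Arrow d a := fun hda => (hE.arrow_of_vStructure hD
          ⟨edge_of_arrow_of_le hE hD hDG hGE hca, edge_of_arrow_of_le hE hD hDG hGE hda, hne,
            fun h => hn ((hE.adjacent_iff hD).2 h)⟩).2 hc.1
        rcases hadj.2 (Or.inl hd.1) with h | h
        · exact ⟨h, not_not.1 fun h' => hpd ⟨h, h'⟩⟩
        · exact ⟨not_not.1 fun h' => hda ⟨h, h'⟩, h⟩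
      rcases hadj.2 (Or.inl hc.1) with h | h
      · exact ⟨h, not_not.1 fun h' => hpc ⟨h, h'⟩⟩
      · exact ⟨not_not.1 fun h' => hnot ⟨h, h'⟩, h⟩
    exact Or.inr (Or.inr (Or.inr (Or.inr ⟨c₁, c₂, hline hl₁ hl₂ hne hn hp₁ hp₂,
      hline hl₂ hl₁ hne.symm (fun h => hn h.symm) hp₂ hp₁, hA h₁, hA h₂, hne,
      fun h => hn (hadj.1 h)⟩)))

end Intermediate

end IsEquivalenceUnion

/-! ### Invariants and termination of the loop. -/

/-- The loop preserves `P`, if the passes do. -/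
theorem _root_.ReplaceUnprotectedRun.invariant {P : MixedGraph p → Prop}
    (hP : ∀ G, P G → ∀ (a b : Fin p) (hab : G.Arrow a b), ¬ StronglyProtected T G a b →
      P (G.addEdge b a hab.ne.symm)) {n : ℕ} (h : ReplaceUnprotectedRun T n G H) (hG : P G) :
    P H := by
  induction h with
  | start => exact hG
  | pass hab hnot _ ih => exact ih (hP _ hG _ _ hab hnot)

theorem numArrows_addEdge_lt (hab : G.Arrow a b) :
    (G.addEdge b a hab.ne.symm).numArrows < G.numArrows := by
  classical
  unfold numArrows
  refine Finset.card_lt_card (Finset.ssubset_iff_of_subset ?_ |>.2 ⟨(a, b), ?_, ?_⟩)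
  · rintro ⟨x, y⟩ hxy
    rw [Finset.mem_filter_univ] at hxy ⊢
    simp only [Arrow, addEdge, not_or] at hxy ⊢
    rcases hxy with ⟨h | ⟨rfl, rfl⟩, h', -⟩
    · exact ⟨h, h'⟩
    · exact absurd hab.1 h'
  · simpa using hab
  · rw [Finset.mem_filter_univ]
    simp [Arrow, addEdge]

theorem _root_.ReplaceUnprotectedRun.le_numArrows {n : ℕ} (h : ReplaceUnprotectedRun T n G H) :
    n ≤ G.numArrows := by
  induction h with
  | start => exact Nat.zero_le _
  | pass hab _ _ ih => exact ih.trans_lt (numArrows_addEdge_lt hab)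

theorem exists_replaceUnprotectedReturns (T : ι → Finset (Fin p)) (G : MixedGraph p) :
    ∃ H, ReplaceUnprotectedReturns T G H := by
  obtain ⟨n, hn⟩ : ∃ n, G.numArrows = n := ⟨_, rfl⟩
  induction n using Nat.strong_induction_on generalizing G with
  | _ n ih =>
    by_cases hG : AllArrowsProtected T G
    · exact ⟨G, ⟨0, .start G⟩, hG⟩
    · simp only [AllArrowsProtected, not_forall] at hG
      obtain ⟨a, b, hab, hnot⟩ := hG
      obtain ⟨H, ⟨m, hm⟩, hH⟩ := ih _ (hn ▸ numArrows_addEdge_lt hab) _ rfl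
      exact ⟨H, ⟨m + 1, .pass hab hnot hm⟩, hH⟩

end MixedGraph

/-! ### Essential graphs and the main theorem. -/

open MixedGraph

theorem isEquivalenceUnion_essentialGraph {p : ℕ} {X : Fin p → Type*}
    [∀ i, MeasurableSpace (X i)] {μ : ∀ i, Measure (X i)} [∀ i, SigmaFinite (μ i)]
    (B : ∀ i, BalancedDensity (μ i)) {ι : Type*} {T : ι → Finset (Fin p)} (hT : IsConservative T)
    {D : MixedGraph p} (hD : D.IsDAG) :
    IsEquivalenceUnion T D (essentialGraph μ T D) := fun _ _ =>
  exists_congr fun _ => and_congr_right fun hD' => and_congr_left' <|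
    ⟨fun h => InterventionallyEquivalent.graphEquivalent hT B h hD' hD,
      fun h => h.interventionallyEquivalent (fun i => (B i).ne_zero) hD' hD⟩

/-- The new pair lies in the essential graph, since arrows of the latter are protected in `G`. A
forbidden subgraph that uses the new line is `x → a - b` or `x → b - a`, and either one is a
configuration protecting `a → b`. -/
theorem IsPartialEssential.addEdge {p : ℕ} {X : Fin p → Type*}
    [∀ i, MeasurableSpace (X i)] {μ : ∀ i, Measure (X i)} {ι : Type*} {T : ι → Finset (Fin p)}
    {D G : MixedGraph p} (hD : D.IsDAG)
    (hE : IsEquivalenceUnion T D (essentialGraph μ T D)) (hG : IsPartialEssential μ T D G)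
    {a b : Fin p} (hab : G.Arrow a b) (hnot : ¬ StronglyProtected T G a b) :
    IsPartialEssential μ T D (G.addEdge b a hab.ne.symm) := by
  obtain ⟨hDG, hGE, hind⟩ := hG
  have hadj : ∀ {x y}, G.Adjacent x y → (G.addEdge b a hab.ne.symm).Adjacent x y := fun h =>
    h.imp Or.inl Or.inl
  refine ⟨fun x y h => Or.inl (hDG x y h), ?_, ?_⟩
  · rintro x y (h | ⟨rfl, rfl⟩)
    · exact hGE x y h
    · by_contra hn
      refine hnot (hE.stronglyProtected_of_arrow hD hDG hGE (fun x y z h h' => ?_)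
        ⟨hGE _ _ hab.1, hn⟩)
      by_contra hxz
      exact hind ⟨x, y, z, h, h', hxz⟩
  · rintro ⟨x, y, z, ⟨hxy, hyx⟩, ⟨hyz, hzy⟩, hn⟩
    simp only [MixedGraph.addEdge, not_or] at hxy hyx hyz hzy
    have hxy' : G.Arrow x y := by
      refine ⟨hxy.resolve_right ?_, hyx.1⟩
      rintro ⟨rfl, rfl⟩
      exact hyx.1 hab.1
    have hn' : ¬ G.Adjacent x z := fun h => hn (hadj h)
    by_cases h₁ : y = a ∧ z = b
    · obtain ⟨rfl, rfl⟩ := h₁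
      refine hnot (Or.inr (Or.inl ⟨x, hxy', ?_, hn'⟩))
      rintro rfl
      exact hxy'.2 hab.1
    by_cases h₂ : y = b ∧ z = a
    · obtain ⟨rfl, rfl⟩ := h₂
      refine hnot (Or.inr (Or.inr (Or.inl ⟨x, hxy', ?_, hn'⟩)))
      rintro rfl
      exact hyx.2 ⟨rfl, rfl⟩
    refine hind ⟨x, y, z, hxy', ⟨hyz.resolve_right h₂, hzy.resolve_right ?_⟩, hn'⟩
    rintro ⟨rfl, rfl⟩
    exact h₁ ⟨rfl, rfl⟩

theorem mainTheorem5 {p : ℕ} {X : Fin p → Type*} [∀ i, MeasurableSpace (X i)]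
    (μ : ∀ i, Measure (X i)) [∀ i, SigmaFinite (μ i)]
    (hμ : ∀ i, ∃ A B : Set (X i), MeasurableSet A ∧ MeasurableSet B ∧ Disjoint A B ∧
      0 < μ i A ∧ 0 < μ i B)
    {ι : Type*} (T : ι → Finset (Fin p)) (hT : IsConservative T)
    (D : MixedGraph p) (hD : D.IsDAG) :
    (∀ G : MixedGraph p,
      IsPartialEssential μ T D G ∧ AllArrowsProtected T G ↔ G = essentialGraph μ T D) ∧
    (∀ G : MixedGraph p, IsPartialEssential μ T D G →
      ∀ (a b : Fin p) (hab : G.Arrow a b), ¬ StronglyProtected T G a b →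
        IsPartialEssential μ T D (G.addEdge b a hab.ne.symm)) ∧
    (∀ G : MixedGraph p, IsPartialEssential μ T D G →
      (∀ (n : ℕ) (H : MixedGraph p), ReplaceUnprotectedRun T n G H →
        IsPartialEssential μ T D H ∧ n ≤ G.numArrows) ∧
      (∀ H : MixedGraph p, ReplaceUnprotectedReturns T G H ↔ H = essentialGraph μ T D)) := by
  have B : ∀ i, BalancedDensity (μ i) := fun i => by
    choose A B hA _ hAB hA' hB' using hμ
    exact (BalancedDensity.nonempty (hA i) (hA' i).ne'
      ((hB' i).trans_le (measure_mono (hAB i).subset_compl_left)).ne').some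
  have hE := isEquivalenceUnion_essentialGraph B hT hD
  have hunique : ∀ G : MixedGraph p,
      IsPartialEssential μ T D G ∧ AllArrowsProtected T G ↔ G = essentialGraph μ T D := by
    intro G
    constructor
    · exact fun ⟨⟨hDG, hGE, _⟩, hG⟩ => hE.eq_of_allArrowsProtected hD hDG hGE hG
    · rintro rfl
      refine ⟨⟨hE.le hD, fun _ _ h => h, ?_⟩, hE.allArrowsProtected hD⟩
      rintro ⟨a, b, c, hab, hbc, hn⟩
      exact hn (hE.not_induced hD hab hbc)
  have hstep : ∀ G : MixedGraph p, IsPartialEssential μ T D G →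
      ∀ (a b : Fin p) (hab : G.Arrow a b), ¬ StronglyProtected T G a b →
        IsPartialEssential μ T D (G.addEdge b a hab.ne.symm) :=
    fun G hG a b hab hnot => hG.addEdge hD hE hab hnot
  have hreturn : ∀ G H : MixedGraph p, IsPartialEssential μ T D G →
      ReplaceUnprotectedReturns T G H → H = essentialGraph μ T D :=
    fun G H hG ⟨⟨_, hrun⟩, hH⟩ => (hunique H).1 ⟨hrun.invariant hstep hG, hH⟩
  refine ⟨hunique, hstep, fun G hG => ⟨fun n H hrun => ⟨hrun.invariant hstep hG,
    hrun.le_numArrows⟩, fun H => ⟨hreturn G H hG, ?_⟩⟩⟩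
  rintro rfl
  obtain ⟨H, hH⟩ := exists_replaceUnprotectedReturns T G
  exact hreturn G H hG hH ▸ hH
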